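/- Let $K$ be a nonarchimedean local field (complete and discretely valued, with finite residue field of $q$ elements), let $L/K$ be a finite unramified Galois extension of degree $n$ with $G=\mathrm{Gal}(L/K)$, and let $\pi\in K^\times$ be a uniformizer. **Conventions.** $H^r$ is group cohomology and $H_T^r$ is Tate cohomology of the finite group $G$. A Frobenius element is a $\sigma\in G$ with $\sigma(x)\equiv x^{q}$ modulo the maximal ideal of $\mathcal O_L$ for all $x\in\mathcal O_L$. Given such a $\sigma$, the invariant map is the composite $$\mathrm{inv}_{L/K}\colon H^2(G,L^\times)\xrightarrow{\ \mathrm{ord}_L\ }H^2(G,\mathbb Z)\xleftarrow[\ \cong\ ]{\ \delta\ }H^1(G,\mathbb Q/\mathbb Z)=\mathrm{Hom}(G,\mathbb Q/\mathbb Z)\xrightarrow{\ f\mapsto f(\sigma)\ }\mathbb Q/\mathbb Z,$$ where $\mathrm{ord}_L$ is the normalised valuation and $\delta$ is the connecting map of $0\to\mathbb Z\to\mathbb Q\to\mathbb Q/\mathbb Z\to 0$. A class $u\in H^2(G,L^\times)$ with $\mathrm{inv}_{L/K}(u)=\frac1n$ is called the fundamental class of $L/K$ and is denoted $u_{L/K}$.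 For a 2-cocycle $\varphi\colon G\times G\to L^\times$, the splitting module $L^\times(\varphi)$ is $L^\times\oplus\bigoplus_{\tau\in G,\,\tau\ne1}\mathbb Z x_\tau$ with $G$ acting as usual on $L^\times$ and by $\tau x_\rho=x_{\tau\rho}-x_\tau+\varphi(\tau,\rho)$ (written additively), where $x_1=\varphi(1,1)$. With the map $x_\tau\mapsto\tau-1$ to the augmentation ideal $I_G$ it gives an exact sequence $0\to L^\times\to L^\times(\varphi)\to I_G\to0$. Write $$r_\varphi\colon G\to G^{\mathrm{ab}}\cong H_T^{-2}(G,\mathbb Z)\to H_T^{-1}(G,I_G)\to H_T^0(G,L^\times)\cong K^\times/\mathrm{Nm}(L^\times)$$ for the composite in which the two middle arrows are the connecting maps of $0\to I_G\to\mathbb Z[G]\to\mathbb Z\to0$ and of $0\to L^\times\to L^\times(\varphi)\to I_G\to0$. The isomorphism $G^{\mathrm{ab}}\cong H_T^{-2}(G,\mathbb Z)$ is normalised so that $g\in G$ has image $[g-1]$ in $H_T^{-1}(G,I_G)$, and the last isomorphism is induced by $(L^\times)^G=K^\times$. **Statement.** There is exactly one Frobenius element $\sigma\in G$; it generates $G$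 and has order $n$. Moreover: 1. $\mathrm{inv}_{L/K}$ is injective with image $\frac1n\mathbb Z/\mathbb Z$; in particular the fundamental class $u_{L/K}$ exists and is unique. 2. There is a 2-cocycle $\varphi\colon G\times G\to L^\times$ that represents $u_{L/K}$ and satisfies, for $0\le i,j\le n-1$, $$\varphi(\sigma^i,\sigma^j)=\begin{cases}1&\text{if } i+j\le n-1,\\ \pi&\text{if } i+j>n-1.\end{cases}$$ 3. For every 2-cocycle $\varphi$ that represents $u_{L/K}$, the map $r_\varphi$ is an isomorphism $G\cong K^\times/\mathrm{Nm}(L^\times)$, and it sends $\sigma$ to the class of $\pi$. -/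

import Mathlib

open CategoryTheory ValuativeRel
open scoped WithZero

noncomputable section

namespace LocalReciprocity

section Ord
variable (F : Type) [Field F] [ValuativeRel F] [TopologicalSpace F] [IsNonarchimedeanLocalField F]

/-- The normalised additive valuation `Fˣ → ℤ` of a nonarchimedean local field. -/
def ord : Additive Fˣ →+ ℤ where
  toFun x := -WithZero.log
    (IsNonarchimedeanLocalField.valueGroupWithZeroIsoInt F (valuation F (x.toMul : F)))
  map_zero' := by simp
  map_add' x y := by
    have h (z : Additive Fˣ) :
        IsNonarchimedeanLocalField.valueGroupWithZeroIsoInt F (valuation F (z.toMul : F)) ≠ 0 := by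
      simp
    simp only [toMul_add, Units.val_mul, map_mul]
    rw [WithZero.log_mul (h x) (h y)]
    ring

variable {F}

theorem ord_pos_iff (x : Additive Fˣ) : 0 < ord F x ↔ valuation F (x.toMul : F) < 1 := by
  have h (z : Additive Fˣ) :
        IsNonarchimedeanLocalField.valueGroupWithZeroIsoInt F (valuation F (z.toMul : F)) ≠ 0 := by
      simp
  simp only [ord, AddMonoidHom.coe_mk, ZeroHom.coe_mk, Left.neg_pos_iff]
  rw [← WithZero.log_one (M := ℤ), WithZero.log_lt_log (h x) one_ne_zero,
    ← map_one (IsNonarchimedeanLocalField.valueGroupWithZeroIsoInt F)]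
  exact (IsNonarchimedeanLocalField.valueGroupWithZeroIsoInt F).strictMono.lt_iff_lt

theorem ord_surjective : Function.Surjective (ord F) := by
  intro n
  obtain ⟨y, hy⟩ := (IsNonarchimedeanLocalField.valueGroupWithZeroIsoInt F).surjective
    (WithZero.exp (-n))
  obtain ⟨x, rfl⟩ := valuation_surjective y
  have hx : x ≠ 0 := by rintro rfl; simp at hy; exact (WithZero.exp_ne_zero hy.symm).elim
  refine ⟨Additive.ofMul (Units.mk0 x hx), ?_⟩
  change -WithZero.log (IsNonarchimedeanLocalField.valueGroupWithZeroIsoInt F (valuation F x)) = n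
  erw [hy]
  simp

end Ord

section Galois
variable (K L : Type) [Field K] [ValuativeRel K] [TopologicalSpace K]
  [IsNonarchimedeanLocalField K]
  [Field L] [ValuativeRel L] [TopologicalSpace L] [IsNonarchimedeanLocalField L]
  [Algebra K L] [ValuativeExtension K L]

/-- powers of an element of valuation `< 1` become small -/
theorem exists_pow_lt {F : Type} [Field F] [ValuativeRel F] [TopologicalSpace F]
    [IsNonarchimedeanLocalField F] {x : F} (hx : valuation F x < 1)
    (γ : ValueGroupWithZero F) (hγ : γ ≠ 0) : ∃ n : ℕ, valuation F x ^ n < γ := by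
  have : MulArchimedean (ValueGroupWithZero F) :=
    ValuativeRel.isRankLeOne_iff_mulArchimedean.mp inferInstance
  exact exists_pow_lt₀ hx (Units.mk0 γ hγ)

theorem continuous_algebraMap_of_valuativeExtension : Continuous (algebraMap K L) := by
  apply continuous_of_continuousAt_zero (algebraMap K L).toAddMonoidHom
  simp only [ContinuousAt, RingHom.toAddMonoidHom_eq_coe, AddMonoidHom.coe_coe, map_zero]
  rw [(IsValuativeTopology.hasBasis_nhds_zero' K).tendsto_iff
    (IsValuativeTopology.hasBasis_nhds_zero' L)]
  intro γ hγ
  obtain ⟨ϖ, hϖ0, hϖ⟩ := Valuation.IsNontrivial.exists_lt_one (v := valuation K)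
  have h1 : valuation L (algebraMap K L ϖ) < 1 := by
    rw [← map_one (ValuativeExtension.mapValueGroupWithZero K L),
      ← ValuativeExtension.mapValueGroupWithZero_valuation]
    exact ValuativeExtension.mapValueGroupWithZero_strictMono hϖ
  obtain ⟨n, hn⟩ := exists_pow_lt h1 γ hγ
  refine ⟨valuation K ϖ ^ n, pow_ne_zero _ (by simpa using hϖ0), fun x hx => ?_⟩
  simp only [Set.mem_ofPred_eq] at hx ⊢
  refine lt_trans ?_ hn
  rw [← ValuativeExtension.mapValueGroupWithZero_valuation, ← map_pow, ← map_pow, ← ValuativeExtension.mapValueGroupWithZero_valuation]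
  rw [← map_pow] at hx
  exact ValuativeExtension.mapValueGroupWithZero_strictMono hx

variable {K L}
variable [FiniteDimensional K L]

theorem continuous_algEquiv (g : L ≃ₐ[K] L) : Continuous g := by
  let := IsTopologicalAddGroup.rightUniformSpace K
  have := isUniformAddGroup_of_addCommGroup (G := K)
  let : (Valued.v (R := K)).RankOne :=
  { hom' := (IsRankLeOne.nonempty.some.emb (R := K)).comp
      MonoidWithZeroHom.ValueGroup₀.embedding
    strictMono' := IsRankLeOne.nonempty.some.strictMono.comp
        MonoidWithZeroHom.ValueGroup₀.embedding_strictMono }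
  let : NontriviallyNormedField K := Valued.toNontriviallyNormedField K (ValueGroupWithZero K)
  have : ContinuousSMul K L :=
    continuousSMul_of_algebraMap K L (continuous_algebraMap_of_valuativeExtension K L)
  have : T2Space L := by
    let := IsTopologicalAddGroup.rightUniformSpace L
    have := isUniformAddGroup_of_addCommGroup (G := L)
    infer_instance
  exact LinearMap.continuous_of_finiteDimensional g.toLinearMap

theorem valuation_algEquiv_lt_one (g : L ≃ₐ[K] L) {x : L} (hx : valuation L x < 1) :
    valuation L (g x) < 1 := by
  have hg : Filter.Tendsto g (nhds 0) (nhds 0) := by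
    simpa using (continuous_algEquiv g).tendsto 0
  rw [(IsValuativeTopology.hasBasis_nhds_zero' L).tendsto_iff
    (IsValuativeTopology.hasBasis_nhds_zero' L)] at hg
  obtain ⟨γ, hγ, h⟩ := hg 1 one_ne_zero
  obtain ⟨n, hn⟩ := exists_pow_lt hx γ hγ
  have := h (x ^ n) (by simpa using hn)
  simp only [map_pow, Set.mem_ofPred_eq] at this
  by_contra hc
  exact absurd this (not_lt.mpr (one_le_pow₀ (not_lt.mp hc)))

theorem ord_algEquiv (g : L ≃ₐ[K] L) (x : Lˣ) :
    ord L (Additive.ofMul (Units.map (g : L →* L) x)) = ord L (Additive.ofMul x) := by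
  let γ (g : L ≃ₐ[K] L) : Additive Lˣ →+ Additive Lˣ :=
    MonoidHom.toAdditive (Units.map (g : L →* L))
  have hpos (g : L ≃ₐ[K] L) (y : Additive Lˣ) (hy : 0 < ord L y) : 0 < ord L (γ g y) := by
    rw [ord_pos_iff] at hy ⊢
    exact valuation_algEquiv_lt_one g hy
  have hinv (g : L ≃ₐ[K] L) (y : Additive Lˣ) : γ g (γ g⁻¹ y) = y := by
    apply Additive.toMul.injective
    ext
    change g (g⁻¹ (y.toMul : L)) = _
    simp
  have hpos' (g : L ≃ₐ[K] L) (y : Additive Lˣ) : 0 < ord L (γ g y) ↔ 0 < ord L y := by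
    refine ⟨fun h => ?_, hpos g y⟩
    have := hpos g⁻¹ _ h
    have h2 := hinv g⁻¹ y
    rw [inv_inv] at h2
    rwa [h2] at this
  have hzero (g : L ≃ₐ[K] L) (y : Additive Lˣ) (hy : ord L y = 0) : ord L (γ g y) = 0 := by
    have h1 := hpos' g y
    have h2 := hpos' g (-y)
    simp only [map_neg] at h2
    omega
  obtain ⟨p, hp⟩ := ord_surjective (F := L) 1
  have key (g : L ≃ₐ[K] L) (y : Additive Lˣ) :
      ord L (γ g y) = ord L y * ord L (γ g p) := by
    have := hzero g (y - ord L y • p) (by simp [hp])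
    simp only [map_sub, map_zsmul, smul_eq_mul] at this
    linarith
  have h1 : ord L (γ g⁻¹ p) * ord L (γ g p) = 1 := by rw [← key, hinv, hp]
  have h2 : 0 < ord L (γ g p) := (hpos' g p).2 (by omega)
  have h3 : ord L (γ g p) = 1 := by
    rcases Int.eq_one_or_neg_one_of_mul_eq_one' h1 with h | h <;> omega
  have := key g (Additive.ofMul x)
  rw [h3, mul_one] at this
  exact this

end Galois

section Sequences

variable {G : Type} [Group G]

theorem rep_shortExact {k : Type} [CommRing k] (S : ShortComplex (Rep.{0} k G)) (hf : Function.Injective S.f.hom)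
    (hg : Function.Surjective S.g.hom) (h : ∀ x, S.g.hom x = 0 → ∃ y, S.f.hom y = x) :
    S.ShortExact where
  exact := (forget₂ (Rep.{0} k G) (ModuleCat.{0} k)).reflects_exact_of_faithful _ <|
    (ShortComplex.moduleCat_exact_iff _).2 h
  mono_f := (Rep.mono_iff_injective _).2 hf
  epi_g := (Rep.epi_iff_surjective _).2 hg

variable (G) in
/-- The sequence `0 → ℤ → ℚ → ℚ/ℤ → 0` of trivial `G`-modules. -/
def qzSeq : ShortComplex (Rep.{0} ℤ G) where
  X₁ := Rep.trivial ℤ G ℤ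
  X₂ := Rep.trivial ℤ G ℚ
  X₃ := Rep.trivial ℤ G (AddCircle (1 : ℚ))
  f := Rep.ofHom ⟨(Int.castAddHom ℚ).toIntLinearMap, fun _ => rfl⟩
  g := Rep.ofHom ⟨(QuotientAddGroup.mk' (AddSubgroup.zmultiples (1 : ℚ))).toIntLinearMap,
    fun _ => rfl⟩
  zero := by
    ext : 1
    apply Representation.IntertwiningMap.ext
    apply LinearMap.ext
    intro n
    change ((n : ℚ) : AddCircle (1 : ℚ)) = 0
    rw [AddCircle.coe_eq_zero_iff]
    exact ⟨n, by simp⟩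

theorem qzSeq_shortExact : (qzSeq G).ShortExact := by
  refine rep_shortExact _ (fun a b h => Int.cast_injective (α := ℚ) h)
    (QuotientAddGroup.mk_surjective) fun x hx => ?_
  obtain ⟨n, hn⟩ := (AddCircle.coe_eq_zero_iff (1 : ℚ)).1 hx
  exact ⟨n, (by simpa using hn : (n : ℚ) = x)⟩

/-- The connecting homomorphism `Hom(G, ℚ/ℤ) = H¹(G, ℚ/ℤ) → H²(G, ℤ)`. -/
def deltaQZ : (Additive G →+ AddCircle (1 : ℚ)) →+ groupCohomology (Rep.trivial ℤ G ℤ) 2 :=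
  ((groupCohomology.H1IsoOfIsTrivial (Rep.trivial ℤ G (AddCircle (1 : ℚ)))).inv ≫
    groupCohomology.δ (qzSeq_shortExact (G := G)) 1 2 rfl).hom.toAddMonoidHom

theorem deltaQZ_apply (f : Additive G →+ AddCircle (1 : ℚ)) (F : G → ℚ)
    (hF : ∀ g, ((F g : ℚ) : AddCircle (1 : ℚ)) = f (Additive.ofMul g))
    (c : groupCohomology.cocycles₂ (Rep.trivial ℤ G ℤ))
    (hc : ∀ g h, ((c (g, h) : ℤ) : ℚ) = F h - F (g * h) + F g) :
    deltaQZ f = groupCohomology.H2π _ c := by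
  refine (groupCohomology.δ₁_apply (qzSeq_shortExact (G := G))
    ((groupCohomology.cocycles₁IsoOfIsTrivial
      (Rep.trivial ℤ G (AddCircle (1 : ℚ)))).inv f) F (funext hF) c.1 ?_)
  funext ⟨g, h⟩
  exact hc g h

theorem deltaQZ_bijective [Finite G] : Function.Bijective (deltaQZ (G := G)) := by
  have := Fintype.ofFinite G
  have hn : (Fintype.card G : ℚ) ≠ 0 := by simp
  constructor
  · rw [injective_iff_map_eq_zero]
    intro f hf
    choose F hF using fun g : G => QuotientAddGroup.mk_surjective (f (Additive.ofMul g))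
    have hint (g h : G) : ∃ n : ℤ, (n : ℚ) = F h - F (g * h) + F g := by
      have : ((F h - F (g * h) + F g : ℚ) : AddCircle (1 : ℚ)) = 0 := by
        have h1 (g : G) : ((F g : ℚ) : AddCircle (1 : ℚ)) = f (Additive.ofMul g) := hF g
        rw [AddCircle.coe_add, AddCircle.coe_sub, h1, h1, h1, ofMul_mul, map_add]
        abel
      obtain ⟨n, hn⟩ := (AddCircle.coe_eq_zero_iff (1 : ℚ)).1 this
      exact ⟨n, by simpa using hn⟩
    choose c hc using hint
    have hcc : (fun p : G × G => c p.1 p.2) ∈ groupCohomology.cocycles₂ (Rep.trivial ℤ G ℤ) := by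
      rw [groupCohomology.mem_cocycles₂_iff]
      intro g h j
      change c (g * h) j + c g h = c h j + c g (h * j)
      have : (((c (g * h) j + c g h : ℤ)) : ℚ) = ((c h j + c g (h * j) : ℤ) : ℚ) := by
        push_cast
        rw [hc, hc, hc, hc, mul_assoc]
        ring
      exact_mod_cast this
    rw [deltaQZ_apply f F hF ⟨_, hcc⟩ hc, groupCohomology.H2π_eq_zero_iff] at hf
    obtain ⟨b, hb⟩ := hf
    have hb' (g h : G) : b h - b (g * h) + b g = c g h := congrFun hb (g, h)
    -- `F - b` is a homomorphism to `ℚ`, hence zero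
    let D : Additive G →+ ℚ := AddMonoidHom.mk' (fun g => F g.toMul - (b g.toMul : ℚ)) (by
      intro g h
      have h1 := hc g.toMul h.toMul
      rw [← hb'] at h1
      push_cast at h1
      simp only [toMul_add]
      linarith)
    ext g
    have h0 : D (Additive.ofMul g) = 0 := by
      have : Fintype.card G • D (Additive.ofMul g) = 0 := by
        rw [← map_nsmul, ← ofMul_pow, pow_card_eq_one, ofMul_one, map_zero]
      simpa using this
    have h1 : F g = (b g : ℚ) := by
      have : F g - (b g : ℚ) = 0 := h0
      linarith
    change f (Additive.ofMul g) = 0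
    rw [← hF g, h1]
    exact (AddCircle.coe_eq_zero_iff (1 : ℚ)).2 ⟨b g, by simp⟩
  · intro x
    induction x using groupCohomology.H2_induction_on with | h c => ?_
    let F (g : G) : ℚ := (∑ h : G, (c (g, h) : ℚ)) / Fintype.card G
    have hF (g h : G) : ((c (g, h) : ℤ) : ℚ) = F h - F (g * h) + F g := by
      have hc := (groupCohomology.mem_cocycles₂_iff _).1 c.2
      have hc' (j : G) : (c (g * h, j) : ℤ) + c (g, h) = c (h, j) + c (g, h * j) := hc g h j
      have hs : ∑ j : G, ((c (g * h, j) : ℤ) : ℚ) + Fintype.card G * (c (g, h) : ℤ) =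
          ∑ j : G, ((c (h, j) : ℤ) : ℚ) + ∑ j : G, ((c (g, j) : ℤ) : ℚ) := by
        rw [← Equiv.sum_comp (Equiv.mulLeft h) (fun j => ((c (g, j) : ℤ) : ℚ)),
          ← Finset.sum_add_distrib]
        simp only [Equiv.coe_mulLeft]
        have : (Fintype.card G : ℚ) * (c (g, h) : ℤ) = ∑ _j : G, ((c (g, h) : ℤ) : ℚ) := by simp
        rw [this, ← Finset.sum_add_distrib]
        refine Finset.sum_congr rfl fun j _ => ?_
        exact_mod_cast hc' j
      simp only [F]
      field_simp
      linarith
    refine ⟨AddMonoidHom.mk' (fun g => ((F g.toMul : ℚ) : AddCircle (1 : ℚ))) ?_,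
      deltaQZ_apply _ F (fun g => rfl) c hF⟩
    intro g h
    rw [toMul_add, ← AddCircle.coe_add, ← sub_eq_zero, ← AddCircle.coe_sub,
      AddCircle.coe_eq_zero_iff]
    refine ⟨-(c (g.toMul, h.toMul) : ℤ), ?_⟩
    have := hF g.toMul h.toMul
    simp only [zsmul_eq_mul, mul_one, Int.cast_neg]
    rw [this]
    ring

/-- The isomorphism `Hom(G, ℚ/ℤ) ≃ H²(G, ℤ)` given by the connecting homomorphism. -/
def deltaQZEquiv [Finite G] :
    (Additive G →+ AddCircle (1 : ℚ)) ≃+ groupCohomology (Rep.trivial ℤ G ℤ) 2 :=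
  AddEquiv.ofBijective deltaQZ deltaQZ_bijective

end Sequences
section Tate

variable {k : Type} [CommRing k] {G : Type} [Group G]

variable (k G) in
/-- The augmentation `k[G] → k`, `g ↦ 1`. -/
def augmentation : Rep.leftRegular k G ⟶ Rep.trivial k G k :=
  Rep.leftRegularHom (Rep.trivial k G k) (1 : k)

/-- The element `g` of `k[G]`. -/
def groupElt (k : Type) [CommRing k] {G : Type} [Group G] (g : G) : Rep.leftRegular k G := MonoidAlgebra.single g (1 : k)

theorem augmentation_groupElt (g : G) : (augmentation k G).hom (groupElt k g) = (1 : k) := by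
  refine (Rep.leftRegularHom_hom_single (A := Rep.trivial k G k) g (1 : k) (1 : k)).trans ?_
  change (1 : k) • (1 : k) = 1
  simp

theorem rho_groupElt (g h : G) :
    (Rep.leftRegular k G).ρ g (groupElt k h) = groupElt k (g * h) :=
  Representation.ofMulAction_single g h (1 : k)

variable (k G) in
/-- The augmentation ideal `I_G`, as a `G`-module. -/
def augIdeal : Rep.{0} k G :=
  Rep.subrepresentation (Rep.leftRegular k G)
    (LinearMap.ker (augmentation k G).hom.toLinearMap) (fun g x hx => by
      change (augmentation k G).hom ((Rep.leftRegular k G).ρ g x) = 0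
      rw [Rep.hom_comm_apply]
      exact hx)

/-- The element `g - 1` of `I_G`. -/
def augElt (k : Type) [CommRing k] {G : Type} [Group G] (g : G) : augIdeal k G :=
  (⟨groupElt k g - groupElt k 1, by
    change (augmentation k G).hom (groupElt k g - groupElt k 1) = 0
    rw [map_sub, augmentation_groupElt, augmentation_groupElt, sub_self]⟩ :
    LinearMap.ker (augmentation k G).hom.toLinearMap)

variable (k G) in
/-- The sequence `0 → I_G → k[G] → k → 0`. -/
def augSeq : ShortComplex (Rep.{0} k G) where
  X₁ := augIdeal k G
  X₂ := Rep.leftRegular k G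
  X₃ := Rep.trivial k G k
  f := Rep.subtype _ _ _
  g := augmentation k G
  zero := by
    ext : 1
    apply Representation.IntertwiningMap.ext
    apply LinearMap.ext
    intro x
    exact x.2

theorem augSeq_shortExact : (augSeq k G).ShortExact := by
  refine rep_shortExact _ Subtype.val_injective (fun n => ?_) fun x hx => ⟨⟨x, hx⟩, rfl⟩
  refine ⟨(show k from n) • (groupElt k (1 : G)), ?_⟩
  change (augmentation k G).hom _ = _
  rw [map_smul, augmentation_groupElt]
  exact mul_one (show k from n)

/-- The coefficient of `h` in an element of `I_G`. -/
def augCoeff (h : G) : augIdeal k G →ₗ[k] k :=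
  Finsupp.lapply h ∘ₗ (MonoidAlgebra.coeffLinearEquiv k).toLinearMap ∘ₗ
    (LinearMap.ker (augmentation k G).hom.toLinearMap).subtype

theorem augCoeff_augElt (h g : G) (hh : h ≠ 1) [Decidable (g = h)] :
    augCoeff h (augElt k g) = if g = h then 1 else 0 := by
  change (MonoidAlgebra.single g (1 : k) - MonoidAlgebra.single 1 (1 : k)).coeff h = _
  classical
  simp [Finsupp.single_apply, hh.symm]

theorem augIdeal_eq_zero (x : augIdeal k G) (h : ∀ g : G, g ≠ 1 → augCoeff g x = 0) : x = 0 := by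
  obtain ⟨x, hx⟩ := x
  have h1 : x = (x.coeff 1) • groupElt k (1 : G) := by
    apply MonoidAlgebra.ext
    ext g
    by_cases hg : g = 1
    · subst hg
      simp [groupElt]
    · have : x.coeff g = 0 := h g hg
      rw [this]
      simp [groupElt, Ne.symm hg]
  have h2 : (augmentation k G).hom x = (0 : k) := hx
  rw [h1, map_smul, augmentation_groupElt] at h2
  have h3 : x.coeff 1 = 0 := by
    change x.coeff 1 • (1 : k) = 0 at h2
    simpa using h2
  apply Subtype.ext
  change x = 0
  rw [h1, h3, zero_smul]

theorem augElt_one : augElt k (1 : G) = 0 :=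
  Subtype.ext (sub_self _)

theorem rho_augElt (g h : G) :
    (augIdeal k G).ρ g (augElt k h) = augElt k (g * h) - augElt k g := by
  apply Subtype.ext
  change (Rep.leftRegular k G).ρ g (groupElt k h - groupElt k 1) =
    (groupElt k (g * h) - groupElt k 1) - (groupElt k g - groupElt k 1)
  rw [map_sub, rho_groupElt, rho_groupElt, mul_one]
  abel

variable (k G) in
/-- The map sending the basis vector indexed by `g ≠ 1` to `g - 1 ∈ I_G`. -/
def augCombination : ({g : G // g ≠ 1} →₀ k) →ₗ[k] augIdeal k G :=
  Finsupp.linearCombination k (fun g : {g : G // g ≠ 1} => (augElt k (g : G) : augIdeal k G))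

theorem augCoeff_augCombination (f : {g : G // g ≠ 1} →₀ k) (h : {g : G // g ≠ 1}) :
    augCoeff (h : G) (augCombination k G f) = f h := by
  classical
  have : augCoeff (h : G) ∘ₗ augCombination k G = Finsupp.lapply h := by
    apply Finsupp.lhom_ext'
    intro g
    apply LinearMap.ext_ring
    simp only [augCombination, LinearMap.coe_comp, Function.comp_apply, Finsupp.lsingle_apply,
      Finsupp.linearCombination_single, one_smul, Finsupp.lapply_apply]
    rw [augCoeff_augElt _ _ h.2, Finsupp.single_apply]
    simp [Subtype.ext_iff]
  exact LinearMap.congr_fun this f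

theorem augCombination_bijective : Function.Bijective (augCombination k G) := by
  classical
  constructor
  · rw [injective_iff_map_eq_zero]
    intro f hf
    ext h
    rw [← augCoeff_augCombination, hf, map_zero, Finsupp.zero_apply]
  · intro x
    let x' : LinearMap.ker (augmentation k G).hom.toLinearMap := x
    let f : {g : G // g ≠ 1} →₀ k := Finsupp.subtypeDomain (fun g : G => g ≠ 1) x'.1.coeff
    refine ⟨f, ?_⟩
    rw [← sub_eq_zero]
    apply augIdeal_eq_zero
    intro g hg
    rw [map_sub, augCoeff_augCombination f ⟨g, hg⟩]
    exact sub_self _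

section Splitting

variable (A : Rep.{0} k G) (φ : groupCohomology.cocycles₂ A)

open Classical in
/-- The elements `x_g` of `A ⊕ ⨁_{g ≠ 1} k x_g`, with `x_1 = φ(1, 1)`. -/
def splittingElt (g : G) : A × ({g : G // g ≠ 1} →₀ k) :=
  if h : g = 1 then (φ (1, 1), 0) else (0, Finsupp.single ⟨g, h⟩ 1)

/-- The endomorphism `a ↦ g a`, `x_h ↦ x_{gh} - x_g + φ(g, h)` of `A ⊕ ⨁_{g ≠ 1} k x_g`. -/
def splittingAction (g : G) :
    (A × ({g : G // g ≠ 1} →₀ k)) →ₗ[k] (A × ({g : G // g ≠ 1} →₀ k)) :=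
  LinearMap.coprod (LinearMap.inl k A ({g : G // g ≠ 1} →₀ k) ∘ₗ A.ρ g)
    (Finsupp.linearCombination k fun h : {g : G // g ≠ 1} =>
      splittingElt A φ (g * h) - splittingElt A φ g + (φ (g, (h : G)), 0))

theorem splittingAction_inl (g : G) (a : A) :
    splittingAction A φ g (a, 0) = (A.ρ g a, 0) := by
  simp [splittingAction]

theorem splittingAction_elt (g h : G) :
    splittingAction A φ g (splittingElt A φ h) =
      splittingElt A φ (g * h) - splittingElt A φ g + (φ (g, h), 0) := by
  by_cases hh : h = 1
  · subst hh
    have : splittingElt A φ 1 = (φ (1, 1), 0) := by simp [splittingElt]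
    rw [this, splittingAction_inl, mul_one, sub_self, zero_add,
      groupCohomology.cocycles₂_map_one_snd φ g]
  · have : splittingElt A φ h = (0, Finsupp.single ⟨h, hh⟩ 1) := by simp [splittingElt, hh]
    rw [this]
    simp [splittingAction]

/-- Two additive maps on the splitting module agree if they agree on `A` and on the `x_g`. -/
theorem splitting_hom_ext {M : Type} [AddCommGroup M] [Module k M]
    {f f' : (A × ({g : G // g ≠ 1} →₀ k)) →ₗ[k] M} (h : ∀ a, f (a, 0) = f' (a, 0))
    (hx : ∀ g, f (splittingElt A φ g) = f' (splittingElt A φ g)) : f = f' := by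
  apply LinearMap.prod_ext
  · ext a
    exact h a
  · apply Finsupp.lhom_ext'
    intro g
    apply LinearMap.ext_ring
    have := hx g
    simpa [splittingElt, g.2] using this

/-- The action of `G` on the splitting module. -/
def splittingRho : Representation k G (A × ({g : G // g ≠ 1} →₀ k)) where
  toFun := splittingAction A φ
  map_one' := by
    apply splitting_hom_ext A φ
    · intro a
      simp [splittingAction_inl]
    · intro g
      rw [splittingAction_elt, one_mul, groupCohomology.cocycles₂_map_one_fst]
      simp [splittingElt]
  map_mul' g h := by
    apply splitting_hom_ext A φ
    · intro a
      simp [splittingAction_inl]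
    · intro j
      have hφ := (groupCohomology.mem_cocycles₂_iff _).1 φ.2 g h j
      change φ (g * h, j) + φ (g, h) = A.ρ g (φ (h, j)) + φ (g, h * j) at hφ
      have hφ' : φ (g * h, j) = A.ρ g (φ (h, j)) + φ (g, h * j) - φ (g, h) := by
        rw [← hφ]; abel
      rw [Module.End.mul_apply, splittingAction_elt, splittingAction_elt, map_add, map_sub,
        splittingAction_elt, splittingAction_elt, splittingAction_inl, hφ', mul_assoc]
      ext : 1
      · simp only [Prod.fst_add, Prod.fst_sub]
        abel
      · simp only [Prod.snd_add, Prod.snd_sub]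
        abel

/-- The splitting module `A(φ)` of a `2`-cocycle `φ`. -/
def splittingModule : Rep.{0} k G := Rep.of (splittingRho A φ)

/-- The sequence `0 → A → A(φ) → I_G → 0`, where `x_g ↦ g - 1`. -/
def splittingSeq : ShortComplex (Rep.{0} k G) where
  X₁ := A
  X₂ := splittingModule A φ
  X₃ := augIdeal k G
  f := Rep.ofHom ⟨LinearMap.inl k A ({g : G // g ≠ 1} →₀ k), fun g => by
    apply LinearMap.ext
    intro a
    exact (splittingAction_inl A φ g a).symm⟩
  g := Rep.ofHom ⟨augCombination k G ∘ₗ LinearMap.snd k A ({g : G // g ≠ 1} →₀ k), fun g => by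
    have key (h : G) : augCombination k G (splittingElt A φ h).2 = augElt k h := by
      by_cases hh : h = 1
      · subst hh
        simp [splittingElt, augElt_one]
      · simp [splittingElt, hh, augCombination]
    apply splitting_hom_ext A φ
    · intro a
      change augCombination k G (splittingAction A φ g (a, 0)).2 = (augIdeal k G).ρ g
        (augCombination k G 0)
      rw [splittingAction_inl, map_zero, map_zero]
    · intro h
      change augCombination k G (splittingAction A φ g (splittingElt A φ h)).2 = (augIdeal k G).ρ g
        (augCombination k G (splittingElt A φ h).2)
      rw [splittingAction_elt, key, rho_augElt]
      simp only [Prod.snd_add, Prod.snd_sub, map_sub, key, add_zero]⟩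
  zero := by
    ext : 1
    apply Representation.IntertwiningMap.ext
    apply LinearMap.ext
    intro a
    exact map_zero (augCombination k G)

theorem splittingSeq_shortExact : (splittingSeq A φ).ShortExact := by
  refine rep_shortExact _ (fun a b h => congrArg Prod.fst h) (fun y => ?_) fun x hx => ?_
  · obtain ⟨f, hf⟩ := augCombination_bijective.2 y
    exact ⟨((0 : A), f), hf⟩
  · have : (x : A × ({g : G // g ≠ 1} →₀ k)).2 = 0 :=
      augCombination_bijective.1 (hx.trans (map_zero _).symm)
    exact ⟨(x : A × ({g : G // g ≠ 1} →₀ k)).1, Prod.ext rfl this.symm⟩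

end Splitting

section TateClasses

theorem homologyπ_eq_zero_iff (C : CochainComplex (ModuleCat.{0} k) ℤ) (i j : ℤ) (hij : i + 1 = j)
    (z : C.cycles j) :
    (C.homologyπ j).hom z = 0 ↔ ∃ y : C.X i, (C.toCycles i j).hom y = z := by
  have hex : (ShortComplex.mk _ _ (C.toCycles_comp_homologyπ i j)).Exact :=
    ShortComplex.exact_of_g_is_cokernel _ (C.homologyIsCokernel i j (by simp [← hij]))
  rw [ShortComplex.moduleCat_exact_iff] at hex
  refine ⟨fun h => hex z h, ?_⟩
  rintro ⟨y, rfl⟩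
  exact congrArg (fun f => f.hom y) (C.toCycles_comp_homologyπ i j)

variable [Fintype G] (M : Rep.{0} k G)

/-- The connecting homomorphism in Tate cohomology. -/
def tateDelta {S : ShortComplex (Rep.{0} k G)} (hS : S.ShortExact) (i j : ℤ) (hij : i + 1 = j) :
    tateCohomology S.X₃ i ⟶ tateCohomology S.X₁ j :=
  (TateCohomology.map_tateComplexFunctor_shortExact hS).δ i j hij

/-- Degree `0` of the Tate complex is `M`. -/
def tateXZero : (tateComplex M).X 0 ≅ ModuleCat.of k M.V := groupCohomology.cochainsIso₀ M

/-- An invariant element, seen in degree `0` of the Tate complex. -/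
def invariantsToX : ModuleCat.of k M.ρ.invariants ⟶ (tateComplex M).X 0 :=
  ModuleCat.ofHom M.ρ.invariants.subtype ≫ (tateXZero M).inv

theorem invariantsToX_d : invariantsToX M ≫ (tateComplex M).d 0 1 = 0 := by
  have h : (ModuleCat.ofHom M.ρ.invariants.subtype ≫ (groupCohomology.cochainsIso₀ M).inv) ≫
      (groupCohomology.inhomogeneousCochains M).d 0 1 = 0 := by
    rw [Category.assoc, groupCohomology.eq_d₀₁_comp_inv,
      groupCohomology.subtype_comp_d₀₁_assoc, Limits.zero_comp]
  exact h

/-- The class map `M^G → H_T⁰(G, M)`. -/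
def tateZeroMk : ModuleCat.of k M.ρ.invariants ⟶ tateCohomology M 0 :=
  (tateComplex M).liftCycles (invariantsToX M) 1 (by simp) (invariantsToX_d M) ≫
    (tateComplex M).homologyπ 0

/-- Degree `-1` of the Tate complex is `M`. -/
def tateXNegOne : (tateComplex M).X (-1) ≅ ModuleCat.of k M.V := groupHomology.chainsIso₀ M

theorem tateXNegOne_d : (tateComplex M).d (-1) 0 =
    (tateXNegOne M).hom ≫ M.norm.toModuleCatHom ≫ (tateXZero M).inv := rfl

/-- An element of norm zero, seen in degree `-1` of the Tate complex. -/
def normKerToX : ModuleCat.of k (LinearMap.ker M.ρ.norm) ⟶ (tateComplex M).X (-1) :=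
  ModuleCat.ofHom (LinearMap.ker M.ρ.norm).subtype ≫ (tateXNegOne M).inv

theorem normKerToX_d : normKerToX M ≫ (tateComplex M).d (-1) 0 = 0 := by
  have h2 : ModuleCat.ofHom (LinearMap.ker M.ρ.norm).subtype ≫ M.norm.toModuleCatHom = 0 := by
    ext x : 2
    exact x.2
  rw [tateXNegOne_d, normKerToX, Category.assoc, Iso.inv_hom_id_assoc, ← Category.assoc, h2,
    Limits.zero_comp]

/-- The class map `ker Nm_G → H_T⁻¹(G, M)`. -/
def tateNegOneMk : ModuleCat.of k (LinearMap.ker M.ρ.norm) ⟶ tateCohomology M (-1) :=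
  (tateComplex M).liftCycles (normKerToX M) 0 (by simp) (normKerToX_d M) ≫
    (tateComplex M).homologyπ (-1)

theorem iCycles_injective (C : CochainComplex (ModuleCat.{0} k) ℤ) (i : ℤ) :
    Function.Injective (C.iCycles i).hom :=
  (ModuleCat.mono_iff_injective _).1 inferInstance

theorem iCycles_liftCycles (x : M.ρ.invariants) :
    ((tateComplex M).iCycles 0).hom (((tateComplex M).liftCycles (invariantsToX M) 1 (by simp)
      (invariantsToX_d M)).hom x) = (tateXZero M).inv.hom x.1 :=
  congrArg (fun f => f.hom x) ((tateComplex M).liftCycles_i (invariantsToX M) 1 (by simp)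
    (invariantsToX_d M))

theorem tateZeroMk_surjective : Function.Surjective (tateZeroMk M).hom := by
  intro y
  obtain ⟨z, rfl⟩ := (ModuleCat.epi_iff_surjective ((tateComplex M).homologyπ 0)).1
    inferInstance y
  let w : (groupCohomology.inhomogeneousCochains M).X 0 := ((tateComplex M).iCycles 0).hom z
  let m : M := (groupCohomology.cochainsIso₀ M).hom.hom w
  have hw : ((groupCohomology.inhomogeneousCochains M).d 0 1).hom w = 0 :=
    congrArg (fun f => f.hom z) ((tateComplex M).iCycles_d 0 1)
  have hm : m ∈ M.ρ.invariants := by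
    rw [← groupCohomology.d₀₁_ker_eq_invariants, LinearMap.mem_ker]
    have h1 := congrArg (fun f => f.hom w) (groupCohomology.comp_d₀₁_eq M)
    refine h1.trans ?_
    change (groupCohomology.cochainsIso₁ M).hom.hom
      (((groupCohomology.inhomogeneousCochains M).d 0 1).hom w) = 0
    rw [hw, map_zero]
  refine ⟨⟨m, hm⟩, ?_⟩
  refine congrArg ((tateComplex M).homologyπ 0).hom ?_
  apply iCycles_injective
  refine (iCycles_liftCycles M ⟨m, hm⟩).trans ?_
  exact congrArg (fun f => f.hom w) (groupCohomology.cochainsIso₀ M).hom_inv_id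

theorem tateZeroMk_eq_zero_iff (x : M.ρ.invariants) :
    (tateZeroMk M).hom x = 0 ↔ ∃ y : M, M.ρ.norm y = x := by
  have h0 : (tateZeroMk M).hom x = 0 ↔ ∃ y : (tateComplex M).X (-1),
      ((tateComplex M).toCycles (-1) 0).hom y = ((tateComplex M).liftCycles (invariantsToX M) 1
        (by simp) (invariantsToX_d M)).hom x :=
    homologyπ_eq_zero_iff (tateComplex M) (-1) 0 (by simp) _
  have h1 (y : (tateComplex M).X (-1)) :
      ((tateComplex M).toCycles (-1) 0).hom y = ((tateComplex M).liftCycles (invariantsToX M) 1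
        (by simp) (invariantsToX_d M)).hom x ↔
      M.ρ.norm ((tateXNegOne M).hom.hom y) = x := by
    rw [← (iCycles_injective (tateComplex M) 0).eq_iff, iCycles_liftCycles]
    have h2 : ((tateComplex M).iCycles 0).hom (((tateComplex M).toCycles (-1) 0).hom y) =
        (tateXZero M).inv.hom
          (M.ρ.norm ((tateXNegOne M).hom.hom y)) :=
      congrArg (fun f => f.hom y) ((tateComplex M).toCycles_i (-1) 0)
    rw [h2]
    exact ((tateXZero M).toLinearEquiv.symm.injective).eq_iff
  rw [h0]
  constructor
  · rintro ⟨y, hy⟩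
    exact ⟨_, (h1 y).1 hy⟩
  · rintro ⟨y, hy⟩
    refine ⟨(tateXNegOne M).inv.hom y, (h1 _).2 ?_⟩
    have : (tateXNegOne M).hom.hom ((tateXNegOne M).inv.hom y) = y :=
      congrArg (fun f => f.hom y) (tateXNegOne M).inv_hom_id
    rw [this, hy]

end TateClasses
section NegTwo

/-- Degree `-2` of a complex obtained by connecting a chain complex to a cochain complex. -/
def connectXNegTwo {K : ChainComplex (ModuleCat.{0} k) ℕ}
    {L : CochainComplex (ModuleCat.{0} k) ℕ} (h : CochainComplex.ConnectData K L) :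
    h.cochainComplex.X (-2) ≅ K.X 1 := Iso.refl (K.X 1)

theorem homologyIsoNeg_inv_liftCycles {K : ChainComplex (ModuleCat.{0} k) ℕ}
    {L : CochainComplex (ModuleCat.{0} k) ℕ} (h : CochainComplex.ConnectData K L)
    {A : ModuleCat.{0} k} (f : A ⟶ K.X 1) (hf : f ≫ K.d 1 0 = 0)
    (hf' : (f ≫ (connectXNegTwo h).inv) ≫ h.cochainComplex.d (-2) (-1) = 0) :
    K.liftCycles f 0 (by simp) hf ≫ K.homologyπ 1 ≫ (h.homologyIsoNeg 1 (-2) (by norm_num)).inv =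
      h.cochainComplex.liftCycles (f ≫ (connectXNegTwo h).inv) (-1) (by simp) hf' ≫
        h.cochainComplex.homologyπ (-2) := by
  have := HomologicalComplex.hasHomology_of_iso h.restrictionLEIso.symm 1
  simp only [CochainComplex.ConnectData.homologyIsoNeg, Iso.trans_inv, Iso.symm_inv,
    HomologicalComplex.homologyMapIso_inv]
  rw [HomologicalComplex.homologyπ_naturality_assoc,
    HomologicalComplex.homologyπ_restrictionHomologyIso_hom]
  simp only [← Category.assoc]
  congr 1
  rw [← cancel_mono (h.cochainComplex.iCycles (-2))]
  simp only [Category.assoc, HomologicalComplex.liftCycles_i]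
  rw [HomologicalComplex.restrictionCyclesIso_hom_iCycles,
    HomologicalComplex.cyclesMap_i_assoc, HomologicalComplex.liftCycles_i_assoc]
  congr 1

theorem delta_homologyπ {S : ShortComplex (CochainComplex (ModuleCat.{0} k) ℤ)}
    (hS : S.ShortExact) (i j : ℤ) (hij : i + 1 = j) (z₃ : S.X₃.cycles i) (x₂ : S.X₂.X i)
    (z₁ : S.X₁.cycles j) (h₂ : (S.g.f i).hom x₂ = (S.X₃.iCycles i).hom z₃)
    (h₁ : (S.f.f j).hom ((S.X₁.iCycles j).hom z₁) = (S.X₂.d i j).hom x₂) :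
    (hS.δ i j hij).hom ((S.X₃.homologyπ i).hom z₃) = (S.X₁.homologyπ j).hom z₁ := by
  refine hS.δ_apply' i j hij _ ((S.X₂.pOpcycles i).hom x₂) z₁ ?_ ?_
  · change (S.X₂.pOpcycles i ≫ HomologicalComplex.opcyclesMap S.g i).hom x₂ =
      (S.X₃.homologyπ i ≫ S.X₃.homologyι i).hom z₃
    rw [HomologicalComplex.p_opcyclesMap, HomologicalComplex.homology_π_ι]
    exact congrArg (S.X₃.pOpcycles i).hom h₂
  · apply (ModuleCat.mono_iff_injective (S.X₂.iCycles j)).1 inferInstance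
    change (HomologicalComplex.cyclesMap S.f j ≫ S.X₂.iCycles j).hom z₁ =
      (S.X₂.pOpcycles i ≫ S.X₂.opcyclesToCycles i j ≫ S.X₂.iCycles j).hom x₂
    rw [HomologicalComplex.cyclesMap_i, HomologicalComplex.pOpcycles_opcyclesToCycles_assoc,
      HomologicalComplex.toCycles_i]
    exact h₁

variable [Fintype G] (M : Rep.{0} k G)

/-- Degree `-2` of the Tate complex is `G →₀ M`. -/
def tateXNegTwo : (tateComplex M).X (-2) ≅ ModuleCat.of k (G →₀ M.V) :=
  connectXNegTwo (tateComplexConnectData M) ≪≫ groupHomology.chainsIso₁ M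

/-- Group homology in degree `1` is Tate cohomology in degree `-2`. -/
def homologyToTate : groupHomology M 1 ≅ tateCohomology M (-2) :=
  ((TateCohomology.isoGroupHomology (-2) 1 (by norm_num)).app M).symm

theorem homologyToTate_H1π (x : groupHomology.cycles₁ M) (z : (tateComplex M).cycles (-2))
    (hz : ((tateComplex M).iCycles (-2)).hom z = (tateXNegTwo M).inv.hom x.1) :
    (homologyToTate M).hom.hom ((groupHomology.H1π M).hom x) =
      ((tateComplex M).homologyπ (-2)).hom z := by
  let K := groupHomology.inhomogeneousChains M
  let h := tateComplexConnectData M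
  let f : ModuleCat.of k (groupHomology.cycles₁ M) ⟶ K.X 1 :=
    (groupHomology.isoCycles₁ M).inv ≫ K.iCycles 1
  have hf : f ≫ K.d 1 0 = 0 := by simp [f]
  have hf' : (f ≫ (connectXNegTwo h).inv) ≫ h.cochainComplex.d (-2) (-1) = 0 := hf
  have h1 : (groupHomology.isoCycles₁ M).inv = K.liftCycles f 0 (by simp) hf := by
    rw [← cancel_mono (K.iCycles 1), HomologicalComplex.liftCycles_i]
  have h2 := congrArg (fun g => g.hom x) (homologyIsoNeg_inv_liftCycles h f hf hf')
  rw [← h1] at h2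
  refine h2.trans (congrArg ((tateComplex M).homologyπ (-2)).hom ?_)
  apply iCycles_injective
  rw [hz]
  refine (congrArg (fun g => g.hom x) (h.cochainComplex.liftCycles_i
    (f ≫ (connectXNegTwo h).inv) (-1) (by simp) hf')).trans ?_
  have h3 : f = (groupHomology.shortComplexH1 M).moduleCatLeftHomologyData.i ≫
      (groupHomology.chainsIso₁ M).inv := groupHomology.isoCycles₁_inv_comp_iCycles M
  rw [h3]
  rfl
variable (G) in
/-- The isomorphism `Gᵃᵇ ≃ H_T⁻²(G, ℤ)`, normalised in such a way that the class of `g` is mapped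
by the connecting homomorphism to the class of `g - 1` in `H_T⁻¹(G, I_G)`,
see `tateDelta_abelToTate`. -/
def abelToTate : Additive (Abelianization G) ≃+ tateCohomology (Rep.trivial ℤ G ℤ) (-2) :=
  (((AddEquiv.neg _).trans (TensorProduct.rid ℤ _).symm.toAddEquiv).trans
    (groupHomology.H1AddEquivOfIsTrivial (Rep.trivial ℤ G ℤ)).symm).trans
    (homologyToTate (Rep.trivial ℤ G ℤ)).toLinearEquiv.toAddEquiv

theorem norm_augElt (g : G) : (augIdeal k G).ρ.norm (augElt k g) = 0 := by
  have h : ∀ j : G, (augIdeal k G).ρ j (augElt k g) = augElt k (j * g) - augElt k j :=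
    fun j => rho_augElt j g
  rw [Representation.norm, LinearMap.sum_apply, Finset.sum_congr rfl fun j _ => h j,
    Finset.sum_sub_distrib, sub_eq_zero]
  exact Fintype.sum_equiv (Equiv.mulRight g) _ _ fun j => rfl

theorem tateXNegTwo_inv_d (g : G) (m : M.V) :
    ((tateComplex M).d (-2) (-1)).hom ((tateXNegTwo M).inv.hom (Finsupp.single g m)) =
      (tateXNegOne M).inv.hom (M.ρ g⁻¹ m - m) := by
  have h := congrArg (fun f => f.hom (Finsupp.single g m)) (groupHomology.eq_d₁₀_comp_inv M)
  refine h.trans ?_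
  exact congrArg (groupHomology.chainsIso₀ M).inv.hom (groupHomology.d₁₀_single M g m)

theorem iCycles_normKer (x : LinearMap.ker M.ρ.norm) :
    ((tateComplex M).iCycles (-1)).hom (((tateComplex M).liftCycles (normKerToX M) 0 (by simp)
      (normKerToX_d M)).hom x) = (tateXNegOne M).inv.hom x.1 :=
  congrArg (fun f => f.hom x) ((tateComplex M).liftCycles_i (normKerToX M) 0 (by simp)
    (normKerToX_d M))

theorem exists_cycle (g : G) (m : M.V) (hm : M.ρ g⁻¹ m = m) :
    ∃ z : (tateComplex M).cycles (-2), ((tateComplex M).iCycles (-2)).hom z =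
      (tateXNegTwo M).inv.hom (Finsupp.single g m) := by
  let f : ModuleCat.of k k ⟶ (tateComplex M).X (-2) :=
    ModuleCat.ofHom (LinearMap.toSpanSingleton k _
      ((tateXNegTwo M).inv.hom (Finsupp.single g m)))
  have hf : f ≫ (tateComplex M).d (-2) (-1) = 0 := by
    apply ModuleCat.hom_ext
    apply LinearMap.ext_ring
    change ((tateComplex M).d (-2) (-1)).hom
      ((1 : k) • (tateXNegTwo M).inv.hom (Finsupp.single g m)) = 0
    rw [one_smul, tateXNegTwo_inv_d, hm, sub_self, map_zero]
  refine ⟨((tateComplex M).liftCycles f (-1) (by simp) hf).hom (1 : k), ?_⟩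
  refine (congrArg (fun g => g.hom (1 : k)) ((tateComplex M).liftCycles_i f (-1) (by simp)
    hf)).trans ?_
  exact one_smul k _

theorem tateMap_negTwo {X Y : Rep.{0} k G} (φ : X ⟶ Y) (g : G) (m : X) :
    ((tateComplex.map φ).f (-2)).hom ((tateXNegTwo X).inv.hom (Finsupp.single g m)) =
      (tateXNegTwo Y).inv.hom (Finsupp.single g (φ.hom m)) := by
  change ((groupHomology.chainsMap (.id G) φ).f 1).hom
    ((groupHomology.chainsIso₁ X).inv.hom (Finsupp.single g m)) =
      (groupHomology.chainsIso₁ Y).inv.hom (Finsupp.single g (φ.hom m))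
  simp [groupHomology.chainsIso₁, groupHomology.chainsMap_id_f_hom_eq_mapRange]

theorem tateMap_negOne {X Y : Rep.{0} k G} (φ : X ⟶ Y) (m : X) :
    ((tateComplex.map φ).f (-1)).hom ((tateXNegOne X).inv.hom m) =
      (tateXNegOne Y).inv.hom (φ.hom m) := by
  change ((groupHomology.chainsMap (.id G) φ).f 0).hom
    ((groupHomology.chainsIso₀ X).inv.hom m) =
      (groupHomology.chainsIso₀ Y).inv.hom (φ.hom m)
  simp [groupHomology.chainsIso₀, groupHomology.chainsMap_id_f_hom_eq_mapRange]

theorem tateDelta_abelToTate (g : G) :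
    (tateDelta augSeq_shortExact (-2) (-1) rfl).hom
      (abelToTate G (Additive.ofMul (Abelianization.of g))) =
      (tateNegOneMk (augIdeal ℤ G)).hom ⟨augElt ℤ g, norm_augElt g⟩ := by
  obtain ⟨z₃, hz₃⟩ := exists_cycle (Rep.trivial ℤ G ℤ) g⁻¹ (1 : ℤ) rfl
  have h1 : abelToTate G (Additive.ofMul (Abelianization.of g)) =
      ((tateComplex (Rep.trivial ℤ G ℤ)).homologyπ (-2)).hom z₃ := by
    refine Eq.trans ?_ (homologyToTate_H1π (Rep.trivial ℤ G ℤ)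
      ((groupHomology.cycles₁IsoOfIsTrivial (Rep.trivial ℤ G ℤ)).inv.hom
        (Finsupp.single g⁻¹ (1 : ℤ))) z₃ hz₃)
    rfl
  rw [h1]
  refine delta_homologyπ (TateCohomology.map_tateComplexFunctor_shortExact
    (augSeq_shortExact (k := ℤ) (G := G))) (-2) (-1) rfl z₃
    ((tateXNegTwo (Rep.leftRegular ℤ G)).inv.hom (Finsupp.single g⁻¹ (groupElt ℤ (1 : G)))) _ ?_ ?_
  · refine (tateMap_negTwo (augmentation ℤ G) g⁻¹ (groupElt ℤ (1 : G))).trans ?_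
    rw [augmentation_groupElt]
    exact hz₃.symm
  · have h2 := iCycles_normKer (augIdeal ℤ G) ⟨augElt ℤ g, norm_augElt g⟩
    refine (congrArg ((tateComplex.map (augSeq ℤ G).f).f (-1)).hom h2).trans ?_
    refine (tateMap_negOne (augSeq ℤ G).f (augElt ℤ g)).trans ?_
    refine Eq.trans ?_ (tateXNegTwo_inv_d (Rep.leftRegular ℤ G) g⁻¹ (groupElt ℤ (1 : G))).symm
    rw [rho_groupElt, inv_inv, mul_one]
    rfl

end NegTwo
end Tate

section Galois

variable (K L : Type) [Field K] [Field L] [Algebra K L] [FiniteDimensional K L] [IsGalois K L]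

/-- The group of norms from `Lˣ`, a subgroup of `Kˣ`. -/
def normSubgroup : Subgroup Kˣ := (Units.map (Algebra.norm K (S := L))).range

/-- The element of `(Lˣ)^G` given by an element of `Kˣ`. -/
def baseUnit (x : Kˣ) : (Rep.ofAlgebraAutOnUnits K L).ρ.invariants :=
  ⟨Additive.ofMul (Units.map (algebraMap K L : K →* L) x), fun g => by
    apply Additive.toMul.injective
    apply Units.ext
    exact g.commutes x⟩

/-- The map `Kˣ = (Lˣ)^G → H_T⁰(G, Lˣ)`. -/
def normResidueMk : Kˣ →* Multiplicative (tateCohomology (Rep.ofAlgebraAutOnUnits K L) 0) :=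
  AddMonoidHom.toMultiplicativeRight <| AddMonoidHom.mk'
    (fun x => (tateZeroMk (Rep.ofAlgebraAutOnUnits K L)).hom (baseUnit K L x.toMul)) (by
      intro x y
      rw [← map_add]
      refine congrArg _ (Subtype.ext ?_)
      apply Additive.toMul.injective
      exact map_mul (Units.map (algebraMap K L : K →* L)) x.toMul y.toMul)

theorem normResidueMk_surjective : Function.Surjective (normResidueMk K L) := by
  intro y
  obtain ⟨z, hz⟩ := tateZeroMk_surjective (Rep.ofAlgebraAutOnUnits K L) y.toAdd
  let u : Lˣ := Additive.toMul z.1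
  have hu (g : L ≃ₐ[K] L) : g (u : L) = u :=
    congrArg (fun a : Additive Lˣ => ((Additive.toMul a : Lˣ) : L)) (z.2 g)
  obtain ⟨x, hx⟩ := (IsGalois.mem_range_algebraMap_iff_fixed (F := K) (u : L)).2 hu
  have hx0 : x ≠ 0 := by
    rintro rfl
    rw [map_zero] at hx
    exact u.ne_zero hx.symm
  refine ⟨Units.mk0 x hx0, ?_⟩
  rw [← ofAdd_toAdd y, ← hz]
  refine congrArg (fun a => Multiplicative.ofAdd ((tateZeroMk _).hom a)) (Subtype.ext ?_)
  apply Additive.toMul.injective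
  exact Units.ext hx

theorem normResidueMk_ker : (normResidueMk K L).ker = normSubgroup K L := by
  ext x
  rw [MonoidHom.mem_ker]
  change (tateZeroMk (Rep.ofAlgebraAutOnUnits K L)).hom (baseUnit K L x) = 0 ↔ _
  rw [tateZeroMk_eq_zero_iff]
  have key (y : Lˣ) : (Rep.ofAlgebraAutOnUnits K L).ρ.norm (Additive.ofMul y) =
      (baseUnit K L x).1 ↔ Units.map (Algebra.norm K (S := L)) y = x := by
    have h := groupCohomology.norm_ofAlgebraAutOnUnits_eq (K := K) y
    constructor
    · intro e
      apply Units.ext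
      apply (algebraMap K L).injective
      exact h.symm.trans (congrArg (fun a : Additive Lˣ => ((Additive.toMul a : Lˣ) : L)) e)
    · intro e
      apply Additive.toMul.injective
      apply Units.ext
      exact h.trans (congrArg (fun u : Kˣ => algebraMap K L u) e)
  constructor
  · rintro ⟨y, hy⟩
    exact ⟨Additive.toMul y, (key _).1 hy⟩
  · rintro ⟨y, hy⟩
    exact ⟨Additive.ofMul y, (key y).2 hy⟩

/-- The isomorphism `Kˣ / Nm(Lˣ) ≃ H_T⁰(G, Lˣ)` induced by `Kˣ = (Lˣ)^G`. -/
def normResidueEquiv : Kˣ ⧸ normSubgroup K L ≃*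
    Multiplicative (tateCohomology (Rep.ofAlgebraAutOnUnits K L) 0) :=
  (QuotientGroup.quotientMulEquivOfEq (normResidueMk_ker K L).symm).trans
    (QuotientGroup.quotientKerEquivOfSurjective _ (normResidueMk_surjective K L))

variable {K L}

/-- The composite `Gᵃᵇ ≃ H_T⁻²(G, ℤ) → H_T⁻¹(G, I_G) → H_T⁰(G, Lˣ)` of the connecting
homomorphisms of `0 → I_G → ℤ[G] → ℤ → 0` and of the sequence `0 → Lˣ → Lˣ(φ) → I_G → 0`
given by a `2`-cocycle `φ`. -/
def tateRecip (φ : groupCohomology.cocycles₂ (Rep.ofAlgebraAutOnUnits K L)) :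
    Additive (Abelianization (L ≃ₐ[K] L)) →+ tateCohomology (Rep.ofAlgebraAutOnUnits K L) 0 :=
  (((tateDelta augSeq_shortExact (-2) (-1) rfl ≫
    tateDelta (splittingSeq_shortExact (Rep.ofAlgebraAutOnUnits K L) φ) (-1) 0
      rfl).hom).toAddMonoidHom).comp
    (abelToTate (L ≃ₐ[K] L)).toAddMonoidHom

/-- The map `G → Kˣ / Nm(Lˣ)` given by `tateRecip`. -/
def recip (φ : groupCohomology.cocycles₂ (Rep.ofAlgebraAutOnUnits K L)) :
    (L ≃ₐ[K] L) →* Kˣ ⧸ normSubgroup K L :=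
  ((normResidueEquiv K L).symm.toMonoidHom.comp
    (AddMonoidHom.toMultiplicativeRight (tateRecip φ))).comp Abelianization.of

end Galois

section Local

variable (K L : Type) [Field K] [ValuativeRel K] [TopologicalSpace K]
  [IsNonarchimedeanLocalField K]
  [Field L] [ValuativeRel L] [TopologicalSpace L] [IsNonarchimedeanLocalField L]
  [Algebra K L]

/-- `L/K` is unramified: the normalised valuation of `L` extends that of `K`. The extension of
(finite) residue fields is automatically separable. -/
def IsUnramifiedExtension : Prop :=
  ∀ x : Kˣ, ord L (Additive.ofMul (Units.map (algebraMap K L : K →* L) x)) =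
    ord K (Additive.ofMul x)

variable {K L}

/-- `σ` acts on the residue field of `L` as `x ↦ x ^ q`, where `q` is the cardinality of the
residue field of `K`. -/
def IsFrobenius (σ : L ≃ₐ[K] L) : Prop :=
  ∀ x : L, x ∈ 𝒪[L] → valuation L (σ x - x ^ Nat.card 𝓀[K]) < 1

variable [ValuativeExtension K L] [FiniteDimensional K L]

variable (K L) in
/-- The valuation `ord : Lˣ → ℤ`, as a morphism of `G`-modules. -/
def ordHom : Rep.ofAlgebraAutOnUnits K L ⟶ Rep.trivial ℤ (L ≃ₐ[K] L) ℤ :=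
  Rep.ofHom ⟨(ord L).toIntLinearMap, fun g => by
    apply LinearMap.ext
    intro x
    exact ord_algEquiv g (Additive.toMul x)⟩

/-- The map `H²(G, Lˣ) → H²(G, ℤ) ≃ Hom(G, ℚ/ℤ) → ℚ/ℤ` given by the valuation, the inverse of
the connecting homomorphism, and the evaluation at `σ`. It is the invariant map when `L/K` is
unramified and `σ` is the Frobenius element. -/
def inv (σ : L ≃ₐ[K] L) :
    groupCohomology (Rep.ofAlgebraAutOnUnits K L) 2 →+ AddCircle (1 : ℚ) :=
  ((AddMonoidHom.eval (Additive.ofMul σ)).comp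
    (deltaQZEquiv (G := L ≃ₐ[K] L)).symm.toAddMonoidHom).comp
    ((groupCohomology.functor ℤ (L ≃ₐ[K] L) 2).map (ordHom K L)).hom.toAddMonoidHom

/-- The class `u` is the fundamental class: its invariant is `1 / [L : K]`. -/
def IsFundamentalClass (σ : L ≃ₐ[K] L)
    (u : groupCohomology (Rep.ofAlgebraAutOnUnits K L) 2) : Prop :=
  inv σ u = ((1 / (Module.finrank K L : ℚ) : ℚ) : AddCircle (1 : ℚ))

end Local

end LocalReciprocity

end

noncomputable section

namespace LocalReciprocity

/-! Everything is read off from one invariant of a 2-cocycle `φ`: the element `S(g) = ∑ τ, φ(τ, g)`,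
which is fixed by `G` and so, for coefficients `Lˣ`, is an element of `Kˣ`.

It plays three roles. Lifting `g - 1` to `x_g` in the splitting module and taking the norm gives
`S(g)`, so the reciprocity map sends `g` to the class of `S(g)` modulo norms
(`tateDelta_splittingSeq`, `recip_eq_mk`). For trivial coefficients `ℤ`, summing the cocycle
identity over its first variable shows that `S / n` bounds the cocycle over `ℚ`, so the invariant of
the class of `φ` is `ord (S(σ)) / n` modulo `ℤ` (`deltaQZ_symm_apply`, `inv_H2π`). Finally, if `σ`
generates `G` and `S(σ)` is a norm, then `φ` is a coboundary (`H2π_eq_zero_of_cocycleSum_eq_norm`).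

The arithmetic input is that an element of `Kˣ` is a norm exactly when `n` divides its valuation
(`mem_normSubgroup_iff`); the hard half is that units are norms, by successive approximation from
the surjectivity of norm and trace on finite fields and the compactness of `𝒪[L]`. That `G` is
generated by a unique Frobenius follows because it embeds in the Galois group of the residue fields
(`residueHom_injective`).

So vanishing invariant means `n ∣ ord (S(σ))`, hence a norm, hence a trivial class. The carry
cocycle has `S(σ) = π` when `n > 1`, hence invariant `1/n`. For any cocycle of invariant `1/n`, `ord
(S(σ)) ≡ 1` modulo `n`, so `S(σ)` and `π` agree modulo norms; and `π` generates `Kˣ / Nm(Lˣ)`, which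
is cyclic of order `n`. -/

theorem sum_mul_left {G M : Type} [Group G] [Fintype G] [AddCommMonoid M] (g : G) (f : G → M) :
    ∑ x : G, f (g * x) = ∑ x : G, f x :=
  Fintype.sum_equiv (Equiv.mulLeft g) _ _ fun _ => rfl

theorem sum_mul_right {G M : Type} [Group G] [Fintype G] [AddCommMonoid M] (g : G) (f : G → M) :
    ∑ x : G, f (x * g) = ∑ x : G, f x :=
  Fintype.sum_equiv (Equiv.mulRight g) _ _ fun _ => rfl

/-! ### The sum of a cocycle over its first variable, and the connecting map of the splitting module
-/

section CocycleSum

variable {k : Type} [CommRing k] {G : Type} [Group G] [Fintype G] (A : Rep.{0} k G)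

/-- The sum `∑ τ, φ(τ, g)` of a `2`-cocycle over its first variable, which is `G`-invariant. -/
def cocycleSum (φ : groupCohomology.cocycles₂ A) (g : G) : A.ρ.invariants :=
  ⟨∑ τ : G, φ (τ, g), fun h => by
    have hφ (τ : G) : A.ρ h (φ (τ, g)) = φ (h * τ, g) + φ (h, τ) - φ (h, τ * g) := by
      have : φ (h * τ, g) + φ (h, τ) = A.ρ h (φ (τ, g)) + φ (h, τ * g) :=
        (groupCohomology.mem_cocycles₂_iff _).1 φ.2 h τ g
      rw [this, add_sub_cancel_right]
    rw [map_sum, Finset.sum_congr rfl fun τ _ => hφ τ, Finset.sum_sub_distrib,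
      Finset.sum_add_distrib, sum_mul_left h (fun τ => φ (τ, g)),
      sum_mul_right g (fun τ => φ (h, τ)), add_sub_cancel_right]⟩

/-- In `∑ τ, (x_{τg} - x_τ + φ(τ, g))` the first two terms cancel after reindexing by right
translation. -/
theorem norm_splittingElt (φ : groupCohomology.cocycles₂ A) (g : G) :
    (splittingModule A φ).ρ.norm (splittingElt A φ g) = ((cocycleSum A φ g : A), 0) := by
  have h (τ : G) : (splittingModule A φ).ρ τ (splittingElt A φ g) =
      splittingElt A φ (τ * g) - splittingElt A φ τ + (φ (τ, g), 0) :=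
    splittingAction_elt A φ τ g
  have key : ∑ τ : G, (splittingElt A φ (τ * g) - splittingElt A φ τ + (φ (τ, g), 0)) =
      ((cocycleSum A φ g : A), 0) := by
    rw [Finset.sum_add_distrib, Finset.sum_sub_distrib,
      sum_mul_right g (fun τ => splittingElt A φ τ), sub_self, zero_add]
    exact (map_sum (LinearMap.inl k A ({g : G // g ≠ 1} →₀ k)) (fun τ => φ (τ, g)) _).symm
  exact (LinearMap.sum_apply _ _ _).trans ((Finset.sum_congr rfl fun τ _ => h τ).trans key)

omit [Fintype G] in
theorem augCombination_splittingElt (φ : groupCohomology.cocycles₂ A) (g : G) :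
    augCombination k G (splittingElt A φ g).2 = augElt k g := by
  by_cases hg : g = 1
  · subst hg
    simp [splittingElt, augElt_one]
  · simp [splittingElt, hg, augCombination]

/-- The connecting map lifts `g - 1` to `x_g` and applies the differential of the Tate complex from
degree `-1` to degree `0`, which is the norm. -/
theorem tateDelta_splittingSeq (φ : groupCohomology.cocycles₂ A) (g : G) :
    (tateDelta (splittingSeq_shortExact A φ) (-1) 0 rfl).hom
      ((tateNegOneMk (augIdeal k G)).hom ⟨augElt k g, norm_augElt g⟩) =
      (tateZeroMk A).hom (cocycleSum A φ g) := by
  refine delta_homologyπ (TateCohomology.map_tateComplexFunctor_shortExact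
    (splittingSeq_shortExact A φ)) (-1) 0 rfl _
    ((tateXNegOne (splittingModule A φ)).inv.hom (splittingElt A φ g)) _ ?_ ?_
  · refine (tateMap_negOne (splittingSeq A φ).g (splittingElt A φ g)).trans ?_
    refine Eq.trans ?_ (iCycles_normKer (augIdeal k G) ⟨augElt k g, norm_augElt g⟩).symm
    exact congrArg (tateXNegOne (augIdeal k G)).inv.hom (augCombination_splittingElt A φ g)
  · refine (congrArg ((tateComplex.map (splittingSeq A φ).f).f 0).hom
      (iCycles_liftCycles A (cocycleSum A φ g))).trans ?_
    have h1 : ((tateComplex (splittingModule A φ)).d (-1) 0).hom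
        ((tateXNegOne (splittingModule A φ)).inv.hom (splittingElt A φ g)) =
        (tateXZero (splittingModule A φ)).inv.hom
          ((splittingModule A φ).ρ.norm (splittingElt A φ g)) := by
      rw [tateXNegOne_d]
      refine congrArg (fun x => (tateXZero (splittingModule A φ)).inv.hom
        ((splittingModule A φ).ρ.norm x)) ?_
      exact congrArg (fun f => f.hom (splittingElt A φ g))
        (tateXNegOne (splittingModule A φ)).inv_hom_id
    refine Eq.trans ?_ h1.symm
    rw [norm_splittingElt]
    change ((groupCohomology.cochainsMap (.id G) (splittingSeq A φ).f).f 0).hom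
      ((groupCohomology.cochainsIso₀ A).inv.hom (cocycleSum A φ g).1) =
      (groupCohomology.cochainsIso₀ (splittingModule A φ)).inv.hom _
    rfl

end CocycleSum

/-! ### The reciprocity map computed by cocycle sums -/

section Recip

variable {K L : Type} [Field K] [Field L] [Algebra K L] [FiniteDimensional K L] [IsGalois K L]

theorem recip_eq_mk (φ : groupCohomology.cocycles₂ (Rep.ofAlgebraAutOnUnits K L))
    (g : L ≃ₐ[K] L) (x : Kˣ)
    (h : cocycleSum (Rep.ofAlgebraAutOnUnits K L) φ g = baseUnit K L x) :
    recip φ g = QuotientGroup.mk x := by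
  change (normResidueEquiv K L).symm (Multiplicative.ofAdd (tateRecip φ
    (Additive.ofMul (Abelianization.of g)))) = _
  rw [MulEquiv.symm_apply_eq]
  have : tateRecip φ (Additive.ofMul (Abelianization.of g)) =
      (tateZeroMk (Rep.ofAlgebraAutOnUnits K L)).hom (baseUnit K L x) := by
    rw [← h, ← tateDelta_splittingSeq, ← tateDelta_abelToTate]
    rfl
  rw [this]
  rfl

end Recip

/-! ### Classes in degree two: explicit invariants, and a vanishing criterion for cyclic groups -/

section Cyclic

variable {G : Type} [Group G] [Fintype G]

/-- Summing the cocycle identity for `(τ, g, h)` over `τ` gives `n c(g, h) = S(h) - S(gh) + S(g)`.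
So `S / n` is a rational cochain with coboundary `c`, and its reduction modulo `ℤ` is the
homomorphism that `δ` sends to the class of `c`. -/
theorem deltaQZ_symm_apply (c : groupCohomology.cocycles₂ (Rep.trivial ℤ G ℤ)) (g : G) :
    (deltaQZEquiv (G := G)).symm (groupCohomology.H2π _ c) (Additive.ofMul g) =
      ((((cocycleSum _ c g).1 : ℤ) / (Fintype.card G : ℚ) : ℚ) : AddCircle (1 : ℚ)) := by
  have hn : (Fintype.card G : ℚ) ≠ 0 := by simp
  let S (g : G) : ℤ := ∑ τ : G, (c (τ, g) : ℤ)
  have hS (g h : G) : (Fintype.card G : ℤ) * (c (g, h) : ℤ) = S h - S (g * h) + S g := by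
    have hc (τ : G) : (c (τ * g, h) : ℤ) + c (τ, g) = c (g, h) + c (τ, g * h) :=
      (groupCohomology.mem_cocycles₂_iff _).1 c.2 τ g h
    have h1 : ∑ τ : G, ((c (τ * g, h) : ℤ) + c (τ, g)) =
        ∑ τ : G, ((c (g, h) : ℤ) + c (τ, g * h)) := Finset.sum_congr rfl fun τ _ => hc τ
    rw [Finset.sum_add_distrib, Finset.sum_add_distrib,
      sum_mul_right g (fun τ => (c (τ, h) : ℤ))] at h1
    simp only [Finset.sum_const, Finset.card_univ, nsmul_eq_mul] at h1
    simp only [S]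
    linarith
  have hF (g h : G) : ((c (g, h) : ℤ) : ℚ) = (S h : ℚ) / Fintype.card G -
      (S (g * h) : ℚ) / Fintype.card G + (S g : ℚ) / Fintype.card G := by
    have := congrArg (Int.cast : ℤ → ℚ) (hS g h)
    push_cast at this
    field_simp
    linarith
  let f : Additive G →+ AddCircle (1 : ℚ) :=
    AddMonoidHom.mk' (fun g => (((S g.toMul : ℚ) / Fintype.card G : ℚ) : AddCircle (1 : ℚ))) (by
      intro g h
      rw [toMul_add, ← AddCircle.coe_add, ← sub_eq_zero, ← AddCircle.coe_sub,
        AddCircle.coe_eq_zero_iff]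
      refine ⟨-(c (g.toMul, h.toMul) : ℤ), ?_⟩
      have := hF g.toMul h.toMul
      simp only [zsmul_eq_mul, mul_one, Int.cast_neg]
      rw [this]
      ring)
  have h1 : deltaQZEquiv f = groupCohomology.H2π _ c :=
    deltaQZ_apply f (fun g => (S g : ℚ) / Fintype.card G) (fun _ => rfl) c hF
  rw [← h1, AddEquiv.symm_apply_apply]
  rfl

omit [Fintype G] in
-- Keeps an explicit representative after a change of coefficients, so that cocycle sums can be
-- compared along `f`.
theorem map_H2π {A B : Rep.{0} ℤ G} (f : A ⟶ B) (φ : groupCohomology.cocycles₂ A) :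
    ∃ c : groupCohomology.cocycles₂ B,
      ((groupCohomology.functor ℤ G 2).map f).hom (groupCohomology.H2π A φ) =
        groupCohomology.H2π B c ∧ ∀ p, c p = f.hom (φ p) :=
  ⟨groupCohomology.mapCocycles₂ (.id G) f φ,
    congrArg (fun f => f.hom φ) (groupCohomology.H2π_comp_map (.id G) f), fun _ => rfl⟩

/-- A `2`-cocycle of a group generated by `σ` is a coboundary if `∑ τ, φ(τ, σ)` is a norm. -/
theorem H2π_eq_zero_of_cocycleSum_eq_norm {k : Type} [CommRing k] (A : Rep.{0} k G) (σ : G)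
    (hσ : ∀ g : G, g ∈ Submonoid.powers σ)
    (φ : groupCohomology.cocycles₂ A) (β : A) (h : A.ρ.norm β = (cocycleSum A φ σ).1) :
    groupCohomology.H2π A φ = 0 := by
  classical
  have hinj : Set.InjOn (fun i : ℕ => σ ^ i) (Finset.range (orderOf σ)) := fun i hi j hj hij =>
    pow_injOn_Iio_orderOf (by simpa using hi) (by simpa using hj) hij
  have himg : (Finset.range (orderOf σ)).image (fun i => σ ^ i) = Finset.univ :=
    Finset.eq_univ_of_forall fun g => by
      have := hσ g
      rw [mem_powers_iff_mem_range_orderOf] at this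
      exact this
  have hsum (f : G → A) : ∑ i ∈ Finset.range (orderOf σ), f (σ ^ i) = ∑ g : G, f g := by
    rw [← himg, Finset.sum_image hinj]
  -- A cochain `b` with coboundary `φ` and `b(σ) = β` must satisfy `b(gσ) = g β + b(g) - φ(g, σ)`,
  -- and `g = 1` forces `b(1) = φ(1, σ)`. `B i` is the resulting value at `σ ^ i`.
  let B (i : ℕ) : A := φ (1, σ) + ∑ j ∈ Finset.range i, (A.ρ (σ ^ j) β - φ (σ ^ j, σ))
  have hB (i : ℕ) : B (i + 1) = A.ρ (σ ^ i) β + B i - φ (σ ^ i, σ) := by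
    simp only [B, Finset.sum_range_succ]
    abel
  -- The increment over a full cycle is `Nm β - S(σ)`; this is the only use of the norm hypothesis,
  -- and it makes `b` well defined on `G`.
  have hB0 : B (orderOf σ) = B 0 := by
    simp only [B, Finset.sum_range_zero]
    rw [hsum (fun g => A.ρ g β - φ (g, σ)), Finset.sum_sub_distrib]
    have : ∑ g : G, A.ρ g β = ∑ g : G, φ (g, σ) := by
      rw [← LinearMap.sum_apply]
      exact h
    rw [this, sub_self]
  choose! e he using fun g => (mem_powers_iff_mem_range_orderOf.1 (hσ g) :
    g ∈ (Finset.range (orderOf σ)).image (fun i => σ ^ i)) |> Finset.mem_image.1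
  let b (g : G) : A := B (e g)
  have hb (g : G) : b (g * σ) = A.ρ g β + b g - φ (g, σ) := by
    have key : b (g * σ) = B (e g + 1) := by
      have h1 := Finset.mem_range.1 (he g).1
      rcases Nat.lt_or_ge (e g + 1) (orderOf σ) with h2 | h2
      · refine congrArg B (hinj (he _).1 (by simpa using h2) ?_)
        change σ ^ (e (g * σ)) = σ ^ (e g + 1)
        rw [(he (g * σ)).2, pow_succ, (he g).2]
      · have h3 : e g + 1 = orderOf σ := by omega
        rw [h3, hB0]
        refine congrArg B (hinj (he _).1 (Finset.mem_coe.2 (Finset.mem_range.2 (orderOf_pos σ))) ?_)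
        change σ ^ (e (g * σ)) = σ ^ 0
        rw [(he (g * σ)).2, ← (he g).2, ← pow_succ, h3, pow_orderOf_eq_one, pow_zero]
    rw [key, hB, (he g).2]
  have hbσ : b σ = β := by
    have := hb 1
    have h1 : b 1 = φ (1, σ) := by
      have : e 1 = 0 := hinj (he _).1
        (Finset.mem_coe.2 (Finset.mem_range.2 (orderOf_pos σ))) (by
        change σ ^ (e 1) = σ ^ 0
        rw [(he 1).2, pow_zero])
      simp [b, this, B]
    rw [one_mul, h1, map_one, add_sub_cancel_right] at this
    exact this
  rw [groupCohomology.H2π_eq_zero_iff]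
  refine ⟨b, ?_⟩
  -- By construction `ψ` vanishes on all pairs `(g, σ)`. The cocycle identity then makes `ψ(g, h)`
  -- unchanged under `h ↦ hσ`, so it vanishes everywhere because `σ` generates `G`.
  let ψ : groupCohomology.cocycles₂ A := φ - ⟨groupCohomology.d₁₂ A b,
    groupCohomology.d₁₂_apply_mem_cocycles₂ b⟩
  have hψ (g h : G) : ψ (g, h) = φ (g, h) - (A.ρ g (b h) - b (g * h) + b g) := rfl
  have hψσ (g : G) : ψ (g, σ) = 0 := by
    rw [hψ, hb, hbσ]
    abel
  have hψmul (g h : G) : ψ (g, h * σ) = ψ (g, h) := by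
    have : ψ (g * h, σ) + ψ (g, h) = A.ρ g (ψ (h, σ)) + ψ (g, h * σ) :=
      (groupCohomology.mem_cocycles₂_iff _).1 ψ.2 g h σ
    rw [hψσ, hψσ, map_zero, zero_add, zero_add] at this
    exact this.symm
  have hψ0 (g h : G) : ψ (g, h) = 0 := by
    have h1 (i : ℕ) : ψ (g, σ ^ (i + 1)) = 0 := by
      induction i with
      | zero => rw [zero_add, pow_one, hψσ]
      | succ i ih => rw [pow_succ, hψmul, ih]
    obtain ⟨i, rfl⟩ := hσ h
    rw [← hψmul, ← pow_succ]
    exact h1 i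
  funext ⟨g, h⟩
  have := hψ0 g h
  rw [hψ, sub_eq_zero] at this
  exact this.symm

end Cyclic

/-! ### The additive valuation and the maximal ideal -/

section OrdValuation

variable {F : Type} [Field F] [ValuativeRel F] [TopologicalSpace F] [IsNonarchimedeanLocalField F]

theorem ord_nonneg_iff (x : Additive Fˣ) : 0 ≤ ord F x ↔ valuation F (x.toMul : F) ≤ 1 := by
  have h := ord_pos_iff (-x)
  rw [map_neg, toMul_neg, Units.val_inv_eq_inv_val, map_inv₀,
    inv_lt_one₀ (by simp [zero_lt_iff])] at h
  rw [← not_lt, ← not_lt, ← h]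
  simp

/-- Discreteness: a positive integer valuation is at least `1`, so a uniformizer generates the
maximal ideal. -/
theorem valuation_le_of_lt_one {p : Fˣ} (hp : ord F (Additive.ofMul p) = 1) {x : F}
    (hx : valuation F x < 1) : valuation F (x / p) ≤ 1 := by
  by_cases h0 : x = 0
  · simp [h0]
  have h1 := (ord_pos_iff (Additive.ofMul (Units.mk0 x h0))).2 hx
  have h2 := (ord_nonneg_iff (Additive.ofMul (Units.mk0 x h0 / p))).1 (by
    rw [ofMul_div, map_sub, hp]; omega)
  simpa using h2

theorem valuation_lt_one_of_ord_eq_one {p : Fˣ} (hp : ord F (Additive.ofMul p) = 1) :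
    valuation F (p : F) < 1 :=
  (ord_pos_iff (Additive.ofMul p)).1 (by omega)

end OrdValuation

/-! ### The Galois action on integers and residue fields; existence of Frobenius; trivial inertia -/

section Residue

variable (K L : Type) [Field K] [ValuativeRel K] [TopologicalSpace K]
  [IsNonarchimedeanLocalField K]
  [Field L] [ValuativeRel L] [TopologicalSpace L] [IsNonarchimedeanLocalField L]
  [Algebra K L] [ValuativeExtension K L]

omit [TopologicalSpace K] [IsNonarchimedeanLocalField K] [TopologicalSpace L]
  [IsNonarchimedeanLocalField L] in
theorem valuation_algebraMap_le_one_iff (x : K) :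
    valuation L (algebraMap K L x) ≤ 1 ↔ valuation K x ≤ 1 := by
  rw [← map_one (ValuativeExtension.mapValueGroupWithZero K L),
    ← ValuativeExtension.mapValueGroupWithZero_valuation]
  exact ValuativeExtension.mapValueGroupWithZero_strictMono.le_iff_le

omit [TopologicalSpace K] [IsNonarchimedeanLocalField K] [TopologicalSpace L]
  [IsNonarchimedeanLocalField L] in
theorem valuation_algebraMap_lt_one_iff (x : K) :
    valuation L (algebraMap K L x) < 1 ↔ valuation K x < 1 := by
  rw [← map_one (ValuativeExtension.mapValueGroupWithZero K L),
    ← ValuativeExtension.mapValueGroupWithZero_valuation]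
  exact ValuativeExtension.mapValueGroupWithZero_strictMono.lt_iff_lt

instance algebraInteger : Algebra 𝒪[K] 𝒪[L] :=
  (((algebraMap K L).comp 𝒪[K].subtype).codRestrict 𝒪[L] fun x =>
    (valuation_algebraMap_le_one_iff K L x).2 x.2).toAlgebra

omit [TopologicalSpace K] [IsNonarchimedeanLocalField K] [TopologicalSpace L]
  [IsNonarchimedeanLocalField L] in
theorem coe_algebraMap_integer (x : 𝒪[K]) :
    ((algebraMap 𝒪[K] 𝒪[L] x : 𝒪[L]) : L) = algebraMap K L x := rfl

theorem mem_maximalIdeal_integer_iff {F : Type} [Field F] [ValuativeRel F] (x : 𝒪[F]) :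
    x ∈ 𝓂[F] ↔ valuation F (x : F) < 1 := by
  rw [IsLocalRing.mem_maximalIdeal, mem_nonunits_iff,
    (Valuation.integer.integers (valuation F)).isUnit_iff_valuation_eq_one]
  exact (lt_iff_le_and_ne.trans (and_iff_right x.2)).symm

/-- Needed for the `𝓀[K]`-algebra structure on `𝓀[L]`. -/
instance isLocalHom_algebraMap_integer : IsLocalHom (algebraMap 𝒪[K] 𝒪[L]) where
  map_nonunit x hx := by
    by_contra h
    rw [← mem_nonunits_iff, ← IsLocalRing.mem_maximalIdeal, mem_maximalIdeal_integer_iff] at h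
    rw [← valuation_algebraMap_lt_one_iff K L, ← coe_algebraMap_integer,
      ← mem_maximalIdeal_integer_iff] at h
    exact h hx

variable [FiniteDimensional K L]
variable {K L}

theorem valuation_algEquiv_le_one (g : L ≃ₐ[K] L) {x : L} (hx : valuation L x ≤ 1) :
    valuation L (g x) ≤ 1 := by
  by_cases h0 : x = 0
  · simp [h0]
  have h := ord_algEquiv g (Units.mk0 x h0)
  have h1 := (ord_nonneg_iff (Additive.ofMul (Units.mk0 x h0))).2 hx
  rw [← h, ord_nonneg_iff] at h1
  exact h1

instance mulSemiringActionInteger : MulSemiringAction (L ≃ₐ[K] L) 𝒪[L] where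
  smul g x := ⟨g x, valuation_algEquiv_le_one g x.2⟩
  one_smul _ := rfl
  mul_smul _ _ _ := rfl
  smul_zero g := Subtype.ext (map_zero g)
  smul_add g x y := Subtype.ext (map_add g (x : L) y)
  smul_one g := Subtype.ext (map_one g)
  smul_mul g x y := Subtype.ext (map_mul g (x : L) y)

theorem coe_smul_integer (g : L ≃ₐ[K] L) (x : 𝒪[L]) : ((g • x : 𝒪[L]) : L) = g x := rfl

theorem smul_algebraMap_integer (g : L ≃ₐ[K] L) (x : 𝒪[K]) :
    g • (algebraMap 𝒪[K] 𝒪[L] x) = algebraMap 𝒪[K] 𝒪[L] x :=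
  Subtype.ext (g.commutes x)

variable (K L) in
/-- The action of the Galois group on the residue field. -/
def residueHom : (L ≃ₐ[K] L) →* (𝓀[L] ≃ₐ[𝓀[K]] 𝓀[L]) where
  toFun g := AlgEquiv.ofRingEquiv (f := MulSemiringAction.toRingEquiv (L ≃ₐ[K] L) 𝓀[L] g) (by
    intro x
    obtain ⟨x, rfl⟩ := IsLocalRing.residue_surjective x
    rw [IsLocalRing.ResidueField.algebraMap_residue, MulSemiringAction.toRingEquiv_apply_apply,
      ← IsLocalRing.ResidueField.residue_smul, smul_algebraMap_integer])
  map_one' := by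
    ext x
    exact one_smul (L ≃ₐ[K] L) x
  map_mul' g h := by
    ext x
    exact mul_smul g h x

theorem residueHom_residue (g : L ≃ₐ[K] L) (x : 𝒪[L]) :
    residueHom K L g (IsLocalRing.residue 𝒪[L] x) = IsLocalRing.residue 𝒪[L] (g • x) := rfl

theorem residue_eq_iff (x y : 𝒪[L]) :
    IsLocalRing.residue 𝒪[L] x = IsLocalRing.residue 𝒪[L] y ↔
      valuation L ((x : L) - y) < 1 := by
  rw [← sub_eq_zero, ← map_sub, IsLocalRing.residue_eq_zero_iff, mem_maximalIdeal_integer_iff]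
  rfl

theorem isFrobenius_iff (σ : L ≃ₐ[K] L) :
    IsFrobenius σ ↔ ∀ x : 𝓀[L], residueHom K L σ x = x ^ Nat.card 𝓀[K] := by
  rw [IsLocalRing.residue_surjective.forall]
  simp only [residueHom_residue, ← map_pow, residue_eq_iff]
  exact ⟨fun h x => h x x.2, fun h x hx => h ⟨x, hx⟩⟩

theorem mem_range_algebraMap_integer [IsGalois K L] (x : 𝒪[L])
    (hx : ∀ g : L ≃ₐ[K] L, g • x = x) : ∃ y : 𝒪[K], algebraMap 𝒪[K] 𝒪[L] y = x := by
  obtain ⟨y, hy⟩ := (IsGalois.mem_range_algebraMap_iff_fixed (F := K) (x : L)).2 fun g =>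
    congrArg Subtype.val (hx g)
  exact ⟨⟨y, (valuation_algebraMap_le_one_iff K L y).1 (hy ▸ x.2)⟩, Subtype.ext hy⟩

/-- The general existence theorem for arithmetic Frobenius elements applies since `𝒪[K]` is the ring
of invariants of `𝒪[L]`; ramification plays no role. As `𝓂[L]` lies over `𝓂[K]`, the exponent there
is the size of `𝓀[K]`. -/
theorem exists_isFrobenius [IsGalois K L] : ∃ σ : L ≃ₐ[K] L, IsFrobenius σ := by
  have hc : SMulCommClass (L ≃ₐ[K] L) 𝒪[K] 𝒪[L] := ⟨fun g a x => by
    rw [Algebra.smul_def, Algebra.smul_def, smul_mul', smul_algebraMap_integer]⟩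
  have hinv : Algebra.IsInvariant 𝒪[K] 𝒪[L] (L ≃ₐ[K] L) := ⟨mem_range_algebraMap_integer⟩
  have : Finite (𝒪[L] ⧸ 𝓂[L]) := inferInstanceAs (Finite 𝓀[L])
  obtain ⟨σ, hσ⟩ := IsArithFrobAt.exists_of_isInvariant (R := 𝒪[K]) (G := L ≃ₐ[K] L) 𝓂[L]
  refine ⟨σ, fun x hx => ?_⟩
  have h1 := (mem_maximalIdeal_integer_iff _).1 (hσ ⟨x, hx⟩)
  have h2 : 𝓂[L].under 𝒪[K] = 𝓂[K] := (Ideal.LiesOver.over (P := 𝓂[L]) (p := 𝓂[K])).symm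
  rw [h2] at h1
  exact h1

variable (hur : IsUnramifiedExtension K L) {ϖ : Kˣ} (hϖ : ord K (Additive.ofMul ϖ) = 1)

omit [ValuativeExtension K L] [FiniteDimensional K L] in
include hur hϖ in
-- Since `L/K` is unramified, `ϖ` is still a uniformizer of `L`.
theorem exists_eq_mul_algebraMap {x : L} (hx : valuation L x < 1) :
    ∃ y : L, valuation L y ≤ 1 ∧ x = algebraMap K L ϖ * y := by
  have := valuation_le_of_lt_one ((hur ϖ).trans hϖ) hx
  refine ⟨_, this, ?_⟩
  have : algebraMap K L ϖ ≠ 0 := by simp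
  simp [mul_div_cancel₀ _ this]

/-- `x ↦ x ^ #k` is the identity on the residue field. -/
theorem valuation_pow_card_sub_lt_one (x : L) (hx : valuation L x ≤ 1) :
    valuation L (x ^ Nat.card 𝓀[L] - x) < 1 := by
  have := Fintype.ofFinite 𝓀[L]
  refine (residue_eq_iff (⟨x, hx⟩ ^ Nat.card 𝓀[L] : 𝒪[L]) ⟨x, hx⟩).1 ?_
  rw [map_pow, Nat.card_eq_fintype_card, FiniteField.pow_card]

include hur hϖ in
-- If `g` is trivial on the residue field, then `g x - x` is divisible by every power of the
-- Galois-fixed uniformizer `p`, hence is zero.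
theorem residueHom_injective : Function.Injective (residueHom K L) := by
  rw [injective_iff_map_eq_one]
  intro g hg
  let p : 𝒪[L] := algebraMap 𝒪[K] 𝒪[L] ⟨ϖ, (ord_nonneg_iff (Additive.ofMul ϖ)).1 (by omega)⟩
  have hgp : g • p = p := smul_algebraMap_integer g _
  have hdvd (x : 𝒪[L]) (hx : valuation L (x : L) < 1) : p ∣ x := by
    obtain ⟨y, hy, h⟩ := exists_eq_mul_algebraMap hur hϖ hx
    exact ⟨⟨y, hy⟩, Subtype.ext h⟩
  have hpm : valuation L (p : L) < 1 := valuation_lt_one_of_ord_eq_one ((hur ϖ).trans hϖ)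
  have hQ : p ∣ (Nat.card 𝓀[L] : 𝒪[L]) := by
    have := Fintype.ofFinite 𝓀[L]
    refine hdvd _ ((mem_maximalIdeal_integer_iff _).1 ?_)
    rw [← IsLocalRing.residue_eq_zero_iff, map_natCast, Nat.card_eq_fintype_card,
      FiniteField.cast_card_eq_zero]
  have key (n : ℕ) : ∀ x : 𝒪[L], p ^ (n + 1) ∣ g • x - x := by
    induction n with
    | zero =>
      intro x
      rw [zero_add, pow_one]
      refine hdvd _ ((residue_eq_iff _ _).1 ?_)
      rw [← residueHom_residue, hg]
      rfl
    | succ n ih =>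
      intro x
      obtain ⟨y, hy⟩ := hdvd (x ^ Nat.card 𝓀[L] - x) (valuation_pow_card_sub_lt_one (x : L) x.2)
      -- Writing `Q` for the size of `𝓀[L]` and `x = x ^ Q - p y`, both terms of `g x - x` gain a
      -- factor `p` over the induction hypothesis.
      have h1 : g • x - x = ((g • x) ^ Nat.card 𝓀[L] - x ^ Nat.card 𝓀[L]) - p * (g • y - y) := by
        have h2 : g • (x ^ Nat.card 𝓀[L] - x) = p * g • y := by rw [hy, smul_mul', hgp]
        rw [smul_sub, smul_pow'] at h2
        linear_combination hy - h2
      rw [h1]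
      refine dvd_sub ?_ ?_
      -- The cofactor of `g x - x` in `(g x) ^ Q - x ^ Q` is congruent to `Q x ^ (Q - 1)` modulo
      -- `p`, and `p ∣ Q`.
      · rw [← geom_sum₂_mul (g • x) x, pow_succ']
        refine mul_dvd_mul ?_ (ih x)
        have h3 : p ∣ g • x - x := (dvd_pow_self p (by omega)).trans (ih x)
        rw [← Ideal.mem_span_singleton, ← Ideal.Quotient.eq] at h3
        rw [← Ideal.mem_span_singleton, ← Ideal.Quotient.eq_zero_iff_mem] at hQ ⊢
        rw [map_sum]
        simp only [map_mul, map_pow, h3]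
        rw [Finset.sum_congr rfl fun i hi => by
          rw [← pow_add, Nat.add_sub_cancel' (by have := Finset.mem_range.1 hi; omega)]]
        rw [Finset.sum_const, Finset.card_range, nsmul_eq_mul]
        rw [map_natCast] at hQ
        rw [hQ, zero_mul]
      · rw [pow_succ']
        exact mul_dvd_mul_left p (ih y)
  have hfix (x : 𝒪[L]) : g • x = x := by
    by_contra hne
    have h0 : ((g • x - x : 𝒪[L]) : L) ≠ 0 := fun h => hne (sub_eq_zero.1 (Subtype.ext h))
    obtain ⟨n, hn⟩ := exists_pow_lt hpm (valuation L ((g • x - x : 𝒪[L]) : L)) (by simpa using h0)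
    obtain ⟨y, hy⟩ := key n x
    have h1 : valuation L ((g • x - x : 𝒪[L]) : L) ≤ valuation L (p : L) ^ (n + 1) := by
      rw [hy]
      simp only [Subring.coe_mul, Subring.coe_pow, map_mul, map_pow]
      exact mul_le_of_le_one_right' y.2
    have h2 : valuation L (p : L) ^ (n + 1) ≤ valuation L (p : L) ^ n :=
      pow_le_pow_right_of_le_one' hpm.le (by omega)
    exact absurd hn (not_lt.2 (h1.trans h2))
  ext x
  -- Either `x` or its inverse is an integer, so fixing `𝒪[L]` is enough.
  rcases le_total (valuation L x) 1 with hx | hx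
  · exact congrArg Subtype.val (hfix ⟨x, hx⟩)
  · have h1 : valuation L x⁻¹ ≤ 1 := by
      rw [map_inv₀]
      exact inv_le_one_of_one_le₀ hx
    have h2 : g x⁻¹ = x⁻¹ := congrArg Subtype.val (hfix ⟨x⁻¹, h1⟩)
    rw [map_inv₀] at h2
    exact inv_injective h2

end Residue

/-! ### The Frobenius generates; approximating units by norms -/

section Unramified

variable {K L : Type} [Field K] [ValuativeRel K] [TopologicalSpace K]
  [IsNonarchimedeanLocalField K]
  [Field L] [ValuativeRel L] [TopologicalSpace L] [IsNonarchimedeanLocalField L]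
  [Algebra K L] [ValuativeExtension K L] [FiniteDimensional K L]

/-- The image of `σ` is the Frobenius of `𝓀[L]` over `𝓀[K]`, whose powers exhaust the Galois group
of finite fields. -/
theorem exists_residueHom_eq_pow {σ : L ≃ₐ[K] L} (hσ : IsFrobenius σ)
    (τ : 𝓀[L] ≃ₐ[𝓀[K]] 𝓀[L]) : ∃ n : ℕ, residueHom K L (σ ^ n) = τ := by
  have := Fintype.ofFinite 𝓀[K]
  have h : residueHom K L σ = FiniteField.frobeniusAlgEquivOfAlgebraic 𝓀[K] 𝓀[L] := by
    ext x
    rw [(isFrobenius_iff σ).1 hσ, FiniteField.coe_frobeniusAlgEquivOfAlgebraic,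
      Nat.card_eq_fintype_card]
  obtain ⟨n, hn⟩ := (FiniteField.bijective_frobeniusAlgEquivOfAlgebraic_pow 𝓀[K] 𝓀[L]).2 τ
  exact ⟨n, by rw [map_pow, h]; exact hn⟩

variable (hur : IsUnramifiedExtension K L) {ϖ : Kˣ} (hϖ : ord K (Additive.ofMul ϖ) = 1)

include hur hϖ

theorem existsUnique_isFrobenius [IsGalois K L] : ∃! σ : L ≃ₐ[K] L, IsFrobenius σ := by
  obtain ⟨σ, hσ⟩ := exists_isFrobenius (K := K) (L := L)
  refine ⟨σ, hσ, fun τ hτ => residueHom_injective hur hϖ ?_⟩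
  ext x
  rw [(isFrobenius_iff σ).1 hσ, (isFrobenius_iff τ).1 hτ]

theorem mem_powers_of_isFrobenius {σ : L ≃ₐ[K] L} (hσ : IsFrobenius σ) (g : L ≃ₐ[K] L) :
    g ∈ Submonoid.powers σ := by
  obtain ⟨n, hn⟩ := exists_residueHom_eq_pow hσ (residueHom K L g)
  exact ⟨n, residueHom_injective hur hϖ hn⟩

theorem zpowers_eq_top_of_isFrobenius {σ : L ≃ₐ[K] L} (hσ : IsFrobenius σ) :
    Subgroup.zpowers σ = ⊤ :=
  (Subgroup.eq_top_iff' _).2 fun g =>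
    (mem_powers_iff_mem_zpowers.1 (mem_powers_of_isFrobenius hur hϖ hσ g))

theorem orderOf_of_isFrobenius [IsGalois K L] {σ : L ≃ₐ[K] L} (hσ : IsFrobenius σ) :
    orderOf σ = Module.finrank K L := by
  rw [← IsGalois.card_aut_eq_finrank, ← Nat.card_zpowers,
    zpowers_eq_top_of_isFrobenius hur hϖ hσ, Subgroup.card_top]

theorem residueHom_bijective [IsGalois K L] : Function.Bijective (residueHom K L) := by
  obtain ⟨σ, hσ⟩ := exists_isFrobenius (K := K) (L := L)
  refine ⟨residueHom_injective hur hϖ, fun τ => ?_⟩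
  obtain ⟨n, hn⟩ := exists_residueHom_eq_pow hσ τ
  exact ⟨_, hn⟩

/-- As `G` is identified with the residual Galois group, norms reduce to norms; likewise for traces
below. -/
theorem residue_prod_smul [IsGalois K L] (x : 𝒪[L]) :
    IsLocalRing.residue 𝒪[L] (∏ g : L ≃ₐ[K] L, g • x) =
      algebraMap 𝓀[K] 𝓀[L] (Algebra.norm 𝓀[K] (IsLocalRing.residue 𝒪[L] x)) := by
  rw [Algebra.norm_eq_prod_automorphisms, map_prod]
  exact Fintype.prod_bijective _ (residueHom_bijective hur hϖ) _ _ fun g => rfl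

theorem residue_sum_smul [IsGalois K L] (x : 𝒪[L]) :
    IsLocalRing.residue 𝒪[L] (∑ g : L ≃ₐ[K] L, g • x) =
      algebraMap 𝓀[K] 𝓀[L] (Algebra.trace 𝓀[K] 𝓀[L] (IsLocalRing.residue 𝒪[L] x)) := by
  rw [trace_eq_sum_automorphisms, map_sum]
  exact Fintype.sum_bijective _ (residueHom_bijective hur hϖ) _ _ fun g => rfl

omit hur hϖ in
/-- `∏ (1 + a fᵢ) ≡ 1 + a ∑ fᵢ` modulo `a ^ 2`. -/
theorem sq_dvd_prod_one_add_sub {R ι : Type*} [CommRing R] (a : R) (f : ι → R) (s : Finset ι) :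
    a ^ 2 ∣ ∏ i ∈ s, (1 + a * f i) - (1 + a * ∑ i ∈ s, f i) := by
  classical
  induction s using Finset.induction_on with
  | empty => simp
  | insert i s hi ih =>
    obtain ⟨c, hc⟩ := ih
    rw [Finset.prod_insert hi, Finset.sum_insert hi]
    refine ⟨(1 + a * f i) * c + f i * ∑ i ∈ s, f i, ?_⟩
    linear_combination (1 + a * f i) * hc

/-- Successive approximation: surjectivity of the residual norm starts the induction. If `Nm y = u +
p ^ (n + 1) w`, replacing `y` by `y (1 + p ^ (n + 1) z)` changes the error to `p ^ (n + 1) (w + u Tr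
z)` modulo `p ^ (n + 2)`, and surjectivity of the residual trace lets `z` cancel it. -/
theorem exists_pow_dvd_prod_smul_sub [IsGalois K L] (p : 𝒪[L])
    (hp : (p : L) = algebraMap K L ϖ) (u : 𝒪[K]) (hu : IsUnit u) (n : ℕ) :
    ∃ y : 𝒪[L], p ^ (n + 1) ∣ ∏ g : L ≃ₐ[K] L, g • y - algebraMap 𝒪[K] 𝒪[L] u := by
  have hdvd (x : 𝒪[L]) (hx : IsLocalRing.residue 𝒪[L] x = 0) : p ∣ x := by
    rw [IsLocalRing.residue_eq_zero_iff, mem_maximalIdeal_integer_iff] at hx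
    obtain ⟨y, hy, h⟩ := exists_eq_mul_algebraMap hur hϖ hx
    exact ⟨⟨y, hy⟩, Subtype.ext (by rw [h, ← hp]; rfl)⟩
  have hgp (g : L ≃ₐ[K] L) : g • p = p := Subtype.ext (by
    rw [coe_smul_integer, hp, g.commutes])
  have hp0 : p ≠ 0 := by
    rintro rfl
    exact ϖ.ne_zero ((map_eq_zero (algebraMap K L)).1 hp.symm)
  induction n with
  | zero =>
    obtain ⟨y, hy⟩ := FiniteField.norm_surjective 𝓀[K] 𝓀[L] (IsLocalRing.residue 𝒪[K] u)
    obtain ⟨y, rfl⟩ := IsLocalRing.residue_surjective y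
    refine ⟨y, ?_⟩
    rw [zero_add, pow_one]
    apply hdvd
    rw [map_sub, residue_prod_smul hur hϖ, hy, IsLocalRing.ResidueField.algebraMap_residue,
      sub_self]
  | succ n ih =>
    obtain ⟨y, w, hw⟩ := ih
    -- The error term must come from `𝒪[K]`, as the residual trace takes values in `𝓀[K]`. It does
    -- because `p ^ (n + 1) w` and `p` are both invariant.
    have hfix (g : L ≃ₐ[K] L) : g • w = w := by
      have h1 : g • (p ^ (n + 1) * w) = p ^ (n + 1) * w := by
        rw [← hw, smul_sub, smul_algebraMap_integer, Finset.smul_prod']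
        congr 1
        exact Fintype.prod_equiv (Equiv.mulLeft g) _ _ fun h => (mul_smul g h y).symm
      rw [smul_mul', smul_pow', hgp] at h1
      exact mul_left_cancel₀ (pow_ne_zero _ hp0) h1
    obtain ⟨w, rfl⟩ := mem_range_algebraMap_integer w hfix
    obtain ⟨z, hz⟩ := Algebra.trace_surjective 𝓀[K] 𝓀[L]
      (-(IsLocalRing.residue 𝒪[K] w / IsLocalRing.residue 𝒪[K] u))
    obtain ⟨z, rfl⟩ := IsLocalRing.residue_surjective z
    obtain ⟨s, hs⟩ : p ∣ algebraMap 𝒪[K] 𝒪[L] w +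
        algebraMap 𝒪[K] 𝒪[L] u * ∑ g : L ≃ₐ[K] L, g • z := by
      apply hdvd
      have hu0 : IsLocalRing.residue 𝒪[K] u ≠ 0 := (hu.map _).ne_zero
      rw [map_add, map_mul, residue_sum_smul hur hϖ, hz,
        ← IsLocalRing.ResidueField.algebraMap_residue,
        ← IsLocalRing.ResidueField.algebraMap_residue, ← map_mul, ← map_add, mul_neg,
        mul_div_cancel₀ _ hu0, add_neg_cancel, map_zero]
    obtain ⟨t, ht⟩ := sq_dvd_prod_one_add_sub (p ^ (n + 1)) (fun g : L ≃ₐ[K] L => g • z)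
      Finset.univ
    refine ⟨y * (1 + p ^ (n + 1) * z), ?_⟩
    have h1 : ∏ g : L ≃ₐ[K] L, g • (y * (1 + p ^ (n + 1) * z)) =
        (∏ g : L ≃ₐ[K] L, g • y) * ∏ g : L ≃ₐ[K] L, (1 + p ^ (n + 1) * g • z) := by
      rw [← Finset.prod_mul_distrib]
      refine Finset.prod_congr rfl fun g _ => ?_
      rw [smul_mul', smul_add, smul_one, smul_mul', smul_pow', hgp]
    -- The last two terms carry `p ^ (2n + 2) = p ^ (n + 2) p ^ n`: the quadratic part of the
    -- product, and the product of the old error with the trace of `z`.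
    refine ⟨s + p ^ n * (t * ∏ g : L ≃ₐ[K] L, g • y) +
      p ^ n * algebraMap 𝒪[K] 𝒪[L] w * ∑ g : L ≃ₐ[K] L, g • z, ?_⟩
    rw [h1]
    linear_combination (∏ g : L ≃ₐ[K] L, g • y) * ht +
      (1 + p ^ (n + 1) * ∑ g : L ≃ₐ[K] L, g • z) * hw + p ^ (n + 1) * hs

end Unramified

/-! ### The norm group of an unramified extension -/

section Norms

variable {K L : Type} [Field K] [ValuativeRel K] [TopologicalSpace K]
  [IsNonarchimedeanLocalField K]
  [Field L] [ValuativeRel L] [TopologicalSpace L] [IsNonarchimedeanLocalField L]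
  [Algebra K L] [ValuativeExtension K L] [FiniteDimensional K L] [IsGalois K L]

theorem ord_norm (hur : IsUnramifiedExtension K L) (y : Lˣ) :
    ord K (Additive.ofMul (Units.map (Algebra.norm K (S := L)) y)) =
      Module.finrank K L * ord L (Additive.ofMul y) := by
  rw [← hur]
  have h : Units.map (algebraMap K L : K →* L) (Units.map (Algebra.norm K (S := L)) y) =
      ∏ g : L ≃ₐ[K] L, Units.map (g : L →* L) y := by
    apply Units.ext
    rw [Units.coe_prod]
    exact Algebra.norm_eq_prod_automorphisms K (y : L)
  rw [h, ofMul_prod, map_sum, Finset.sum_congr rfl fun g _ => ord_algEquiv g y,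
    Finset.sum_const, Finset.card_univ, nsmul_eq_mul, ← Nat.card_eq_fintype_card,
    IsGalois.card_aut_eq_finrank]

variable (hur : IsUnramifiedExtension K L) {ϖ : Kˣ} (hϖ : ord K (Additive.ofMul ϖ) = 1)

include hur hϖ

theorem mem_normSubgroup_of_ord_eq_zero (u : Kˣ) (hu : ord K (Additive.ofMul u) = 0) :
    u ∈ normSubgroup K L := by
  have hT2 : T2Space L := by
    let := IsTopologicalAddGroup.rightUniformSpace L
    have := isUniformAddGroup_of_addCommGroup (G := L)
    infer_instance
  have hu1 : valuation K (u : K) ≤ 1 := (ord_nonneg_iff (Additive.ofMul u)).1 hu.ge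
  have hu2 : valuation K ((u⁻¹ : Kˣ) : K) ≤ 1 := (ord_nonneg_iff (-Additive.ofMul u)).1 (by
    rw [map_neg, hu, neg_zero])
  let u' : 𝒪[K] := ⟨u, hu1⟩
  have hu' : IsUnit u' := IsUnit.of_mul_eq_one ⟨_, hu2⟩ (Subtype.ext u.mul_inv)
  let p : 𝒪[L] := algebraMap 𝒪[K] 𝒪[L] ⟨ϖ, (ord_nonneg_iff (Additive.ofMul ϖ)).1 (by omega)⟩
  have hpm : valuation L (p : L) < 1 := valuation_lt_one_of_ord_eq_one ((hur ϖ).trans hϖ)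
  choose y hy using exists_pow_dvd_prod_smul_sub hur hϖ p rfl u' hu'
  let N (x : 𝒪[L]) : L := ∏ g : L ≃ₐ[K] L, g x
  have hN : Continuous N :=
    continuous_finsetProd _ fun g _ => (continuous_algEquiv g).comp continuous_subtype_val
  have hNy (n : ℕ) : N (y n) = ((∏ g : L ≃ₐ[K] L, g • y n : 𝒪[L]) : L) :=
    (map_prod 𝒪[L].subtype (fun g : L ≃ₐ[K] L => g • y n) Finset.univ).symm
  -- The approximations only place `u` in the closure of the norms of integers; that set is closed,
  -- being a continuous image of the compact ring `𝒪[L]`.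
  have hmem : algebraMap K L u ∈ closure (Set.range N) := by
    have ht : Filter.Tendsto (fun n => N (y n) - algebraMap K L u) Filter.atTop (nhds 0) := by
      rw [(IsValuativeTopology.hasBasis_nhds_zero' L).tendsto_right_iff]
      intro γ hγ
      obtain ⟨m, hm⟩ := exists_pow_lt hpm γ hγ
      filter_upwards [Filter.eventually_ge_atTop m] with n hn
      obtain ⟨c, hc⟩ := hy n
      have h1 : N (y n) - algebraMap K L u = (p : L) ^ (n + 1) * c := by
        rw [hNy]
        exact congrArg Subtype.val hc
      rw [h1, map_mul, map_pow]
      exact ((mul_le_of_le_one_right' c.2).trans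
        (pow_le_pow_right_of_le_one' hpm.le (by omega))).trans_lt hm
    have ht' := ht.add_const (algebraMap K L u)
    simp only [sub_add_cancel, zero_add] at ht'
    exact mem_closure_of_tendsto ht' (Filter.Eventually.of_forall fun n => ⟨y n, rfl⟩)
  rw [(isCompact_range hN).isClosed.closure_eq] at hmem
  obtain ⟨x, hx⟩ := hmem
  have hx1 : Algebra.norm K (x : L) = u :=
    (algebraMap K L).injective ((Algebra.norm_eq_prod_automorphisms K (x : L)).trans hx)
  have hx0 : (x : L) ≠ 0 := by
    intro h
    rw [h, Algebra.norm_zero] at hx1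
    exact u.ne_zero hx1.symm
  exact ⟨Units.mk0 x hx0, Units.ext hx1⟩

/-- Modulo units, which are norms, an element of valuation `n k` is `ϖ ^ (n k)`, the norm of `ϖ ^
k`. -/
theorem mem_normSubgroup_iff (x : Kˣ) :
    x ∈ normSubgroup K L ↔ (Module.finrank K L : ℤ) ∣ ord K (Additive.ofMul x) := by
  constructor
  · rintro ⟨y, rfl⟩
    exact ⟨_, ord_norm hur y⟩
  · rintro ⟨k, hk⟩
    have h1 : Units.map (Algebra.norm K (S := L))
        (Units.map (algebraMap K L : K →* L) (ϖ ^ k)) = ϖ ^ (Module.finrank K L * k : ℤ) := by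
      rw [zpow_mul', zpow_natCast]
      exact Units.ext (Algebra.norm_algebraMap _)
    have h2 : x / ϖ ^ (Module.finrank K L * k : ℤ) ∈ normSubgroup K L := by
      apply mem_normSubgroup_of_ord_eq_zero hur hϖ
      rw [ofMul_div, ofMul_zpow, map_sub, map_zsmul, hk, hϖ]
      simp
    have h3 : ϖ ^ (Module.finrank K L * k : ℤ) ∈ normSubgroup K L := ⟨_, h1⟩
    simpa using mul_mem h2 h3

end Norms

/-! ### The carry cocycle of a cyclic group -/

section Carry

variable {k : Type} [CommRing k] {G : Type} [Group G]

/-- For a finite cyclic group of order `n` generated by `σ`, an invariant element `a` defines a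
`2`-cocycle with value `0` or `a` at `(σ ^ i, σ ^ j)`, according to whether `i + j < n`. -/
theorem exists_carryCocycle [Finite G] (A : Rep.{0} k G) (σ : G)
    (hσ : ∀ g : G, g ∈ Submonoid.powers σ) (a : A.ρ.invariants) :
    ∃ φ : groupCohomology.cocycles₂ A, ∀ i j : ℕ, i < orderOf σ → j < orderOf σ →
      φ (σ ^ i, σ ^ j) = if i + j ≤ orderOf σ - 1 then (0 : A) else a.1 := by
  classical
  choose! e he using fun g => (mem_powers_iff_mem_range_orderOf.1 (hσ g) :
    g ∈ (Finset.range (orderOf σ)).image (fun i => σ ^ i)) |> Finset.mem_image.1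
  have hlt (g : G) : e g < orderOf σ := Finset.mem_range.1 (he g).1
  have hpow (i : ℕ) (hi : i < orderOf σ) : e (σ ^ i) = i :=
    pow_injOn_Iio_orderOf (hlt _) hi (he (σ ^ i)).2
  let c (g h : G) : ℤ := if e g + e h ≤ orderOf σ - 1 then 0 else 1
  -- With `e` the exponent in `[0, n)`, the carry `c` is the coboundary of `e / n`; the cocycle
  -- identity follows after cancelling `n`.
  have hc (g h : G) : (orderOf σ : ℤ) * c g h = e g + e h - e (g * h) := by
    have h1 : σ ^ (e g + e h) = g * h := by rw [pow_add, (he g).2, (he h).2]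
    have hg := hlt g
    have hh := hlt h
    simp only [c]
    split_ifs with hle
    · rw [← h1, hpow _ (by omega)]
      push_cast
      ring
    · have h2 : σ ^ (e g + e h - orderOf σ) = g * h := by
        rw [← h1]
        conv_rhs => rw [show e g + e h = e g + e h - orderOf σ + orderOf σ by omega, pow_add,
          pow_orderOf_eq_one, mul_one]
      rw [← h2, hpow _ (by omega)]
      push_cast [show orderOf σ ≤ e g + e h by omega]
      ring
  have hn : (orderOf σ : ℤ) ≠ 0 := by
    have := orderOf_pos σ
    omega
  have hcoc (g h j : G) : c (g * h) j + c g h = c h j + c g (h * j) := by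
    apply mul_left_cancel₀ hn
    rw [mul_add, mul_add, hc, hc, hc, hc, mul_assoc]
    ring
  refine ⟨⟨fun q => c q.1 q.2 • (a : A), ?_⟩, fun i j hi hj => ?_⟩
  · rw [groupCohomology.mem_cocycles₂_iff]
    intro g h j
    have ha : A.ρ g a.1 = a.1 := a.2 g
    change c (g * h) j • (a : A) + c g h • (a : A) =
      A.ρ g (c h j • (a : A)) + c g (h * j) • (a : A)
    rw [map_zsmul, ha, ← add_smul, ← add_smul, hcoc]
  · change c (σ ^ i) (σ ^ j) • (a : A) = _
    simp only [c, hpow i hi, hpow j hj]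
    split_ifs <;> simp

/-- Adding `1` to an exponent carries only at `σ ^ (n - 1)`. For `n = 1` this fails: then `σ = σ ^
0` and the sum is `0`. -/
theorem cocycleSum_of_carry [Fintype G] (A : Rep.{0} k G) (σ : G)
    (hσ : ∀ g : G, g ∈ Submonoid.powers σ) (a : A)
    (φ : groupCohomology.cocycles₂ A) (hφ : ∀ i j : ℕ, i < orderOf σ → j < orderOf σ →
      φ (σ ^ i, σ ^ j) = if i + j ≤ orderOf σ - 1 then (0 : A) else a) (h1 : 1 < orderOf σ) :
    (cocycleSum A φ σ).1 = a := by
  change ∑ τ : G, φ (τ, σ) = a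
  rw [Finset.sum_eq_single (σ ^ (orderOf σ - 1))]
  · have := hφ (orderOf σ - 1) 1 (by omega) h1
    rw [pow_one, if_neg (by omega)] at this
    exact this
  · intro τ _ hτ
    have h2 := hσ τ
    classical
    rw [mem_powers_iff_mem_range_orderOf] at h2
    obtain ⟨i, hi, rfl⟩ := Finset.mem_image.1 h2
    have hi' := Finset.mem_range.1 hi
    have := hφ i 1 hi' h1
    rw [pow_one, if_pos] at this
    · exact this
    · by_contra hlt
      exact hτ (by rw [show i = orderOf σ - 1 by omega])
  · simp

end Carry

/-! ### The invariant map, the fundamental class and reciprocity -/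

section Invariant

theorem exists_baseUnit_eq {K L : Type} [Field K] [Field L] [Algebra K L] [FiniteDimensional K L]
    [IsGalois K L] (z : (Rep.ofAlgebraAutOnUnits K L).ρ.invariants) :
    ∃ x : Kˣ, baseUnit K L x = z := by
  let u : Lˣ := Additive.toMul z.1
  have hu (g : L ≃ₐ[K] L) : g (u : L) = u :=
    congrArg (fun a : Additive Lˣ => ((Additive.toMul a : Lˣ) : L)) (z.2 g)
  obtain ⟨x, hx⟩ := (IsGalois.mem_range_algebraMap_iff_fixed (F := K) (u : L)).2 hu
  have hx0 : x ≠ 0 := by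
    rintro rfl
    rw [map_zero] at hx
    exact u.ne_zero hx.symm
  refine ⟨Units.mk0 x hx0, Subtype.ext ?_⟩
  apply Additive.toMul.injective
  exact Units.ext hx

theorem norm_ofAlgebraAutOnUnits {K L : Type} [Field K] [Field L] [Algebra K L]
    [FiniteDimensional K L] [IsGalois K L] (y : Lˣ) :
    (Rep.ofAlgebraAutOnUnits K L).ρ.norm (Additive.ofMul y) =
      (baseUnit K L (Units.map (Algebra.norm K (S := L)) y)).1 := by
  apply Additive.toMul.injective
  apply Units.ext
  exact groupCohomology.norm_ofAlgebraAutOnUnits_eq (K := K) y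

variable {K L : Type} [Field K] [ValuativeRel K] [TopologicalSpace K]
  [IsNonarchimedeanLocalField K]
  [Field L] [ValuativeRel L] [TopologicalSpace L] [IsNonarchimedeanLocalField L]
  [Algebra K L] [ValuativeExtension K L] [FiniteDimensional K L] [IsGalois K L]

/-- `ord` commutes with the sum over `τ`, and unramifiedness replaces `ord L` by `ord K` on the
invariant element `S(σ)`. -/
theorem inv_H2π (hur : IsUnramifiedExtension K L) (σ : L ≃ₐ[K] L)
    (φ : groupCohomology.cocycles₂ (Rep.ofAlgebraAutOnUnits K L)) (x : Kˣ)
    (hx : cocycleSum (Rep.ofAlgebraAutOnUnits K L) φ σ = baseUnit K L x) :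
    inv σ (groupCohomology.H2π _ φ) =
      (((ord K (Additive.ofMul x) : ℚ) / (Module.finrank K L : ℚ) : ℚ) : AddCircle (1 : ℚ)) := by
  obtain ⟨c, hc, hcφ⟩ := map_H2π (ordHom K L) φ
  change (deltaQZEquiv (G := L ≃ₐ[K] L)).symm
    (((groupCohomology.functor ℤ (L ≃ₐ[K] L) 2).map (ordHom K L)).hom
      (groupCohomology.H2π _ φ)) (Additive.ofMul σ) = _
  rw [hc, deltaQZ_symm_apply, ← Nat.card_eq_fintype_card, IsGalois.card_aut_eq_finrank]
  have h1 : ((cocycleSum _ c σ).1 : ℤ) = ord K (Additive.ofMul x) := by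
    have h2 : ord L ((cocycleSum (Rep.ofAlgebraAutOnUnits K L) φ σ).1 : Additive Lˣ) =
        ord K (Additive.ofMul x) := by
      rw [hx]
      exact hur x
    rw [← h2]
    refine (Finset.sum_congr rfl fun τ _ => hcφ (τ, σ)).trans ?_
    exact (map_sum (ord L) (fun τ : L ≃ₐ[K] L => φ (τ, σ)) Finset.univ).symm
  rw [h1]

theorem coe_div_eq_coe_div_iff {n : ℕ} (hn : n ≠ 0) (a b : ℤ) :
    (((a : ℚ) / (n : ℚ) : ℚ) : AddCircle (1 : ℚ)) = (((b : ℚ) / (n : ℚ) : ℚ) : AddCircle (1 : ℚ)) ↔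
      (n : ℤ) ∣ a - b := by
  have hn' : (n : ℚ) ≠ 0 := by exact_mod_cast hn
  rw [← sub_eq_zero, ← AddCircle.coe_sub, AddCircle.coe_eq_zero_iff]
  refine exists_congr fun m => ?_
  rw [zsmul_eq_mul, mul_one, ← sub_div, eq_div_iff hn', mul_comm, eq_comm]
  exact_mod_cast Iff.rfl

variable (hur : IsUnramifiedExtension K L) {ϖ : Kˣ} (hϖ : ord K (Additive.ofMul ϖ) = 1)
  {σ : L ≃ₐ[K] L} (hσ : IsFrobenius σ)

include hur hϖ hσ

theorem inv_injective : Function.Injective (inv σ) := by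
  rw [injective_iff_map_eq_zero]
  intro u hu
  induction u using groupCohomology.H2_induction_on with | h φ => ?_
  obtain ⟨x, hx⟩ := exists_baseUnit_eq (cocycleSum (Rep.ofAlgebraAutOnUnits K L) φ σ)
  rw [inv_H2π hur σ φ x hx.symm] at hu
  have h1 : (Module.finrank K L : ℤ) ∣ ord K (Additive.ofMul x) := by
    rw [← sub_zero (ord K (Additive.ofMul x)),
      ← coe_div_eq_coe_div_iff Module.finrank_pos.ne', hu]
    simp
  obtain ⟨y, hy⟩ := (mem_normSubgroup_iff hur hϖ x).2 h1
  refine H2π_eq_zero_of_cocycleSum_eq_norm _ σ (mem_powers_of_isFrobenius hur hϖ hσ) φ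
    (Additive.ofMul y) ?_
  rw [norm_ofAlgebraAutOnUnits, hy, hx]

theorem exists_carryCocycle_isFundamentalClass :
    ∃ φ : groupCohomology.cocycles₂ (Rep.ofAlgebraAutOnUnits K L),
      (∀ i j : ℕ, i < Module.finrank K L → j < Module.finrank K L →
        φ (σ ^ i, σ ^ j) = Additive.ofMul (if i + j ≤ Module.finrank K L - 1 then 1
          else Units.map (algebraMap K L : K →* L) ϖ)) ∧
      IsFundamentalClass σ (groupCohomology.H2π _ φ) := by
  have hgen := mem_powers_of_isFrobenius hur hϖ hσ
  have hn := orderOf_of_isFrobenius hur hϖ hσ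
  obtain ⟨φ, hφ⟩ := exists_carryCocycle (Rep.ofAlgebraAutOnUnits K L) σ hgen (baseUnit K L ϖ)
  have hφ' := hφ
  rw [hn] at hφ'
  refine ⟨φ, fun i j hi hj => (hφ' i j hi hj).trans ?_, ?_⟩
  · split_ifs <;> rfl
  obtain ⟨x, hx⟩ := exists_baseUnit_eq (cocycleSum (Rep.ofAlgebraAutOnUnits K L) φ σ)
  rw [IsFundamentalClass, inv_H2π hur σ φ x hx.symm]
  have := coe_div_eq_coe_div_iff (Module.finrank_pos (R := K) (M := L)).ne'
    (ord K (Additive.ofMul x)) 1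
  rw [Int.cast_one] at this
  rw [this]
  rcases Nat.lt_or_ge 1 (Module.finrank K L) with h1 | h1
  · have h2 := cocycleSum_of_carry _ σ hgen _ φ hφ (hn ▸ h1)
    have h3 : x = ϖ := by
      apply Units.ext
      apply (algebraMap K L).injective
      exact congrArg (fun a : Additive Lˣ => ((Additive.toMul a : Lˣ) : L))
        ((congrArg Subtype.val hx).trans h2)
    rw [h3, hϖ, sub_self]
    exact dvd_zero _
  -- In degree one the cocycle sum is not `ϖ`, but the required congruence is modulo `1`.
  · have h2 : Module.finrank K L = 1 := le_antisymm h1 Module.finrank_pos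
    rw [h2]
    exact one_dvd _

theorem range_inv : (inv σ).range =
    AddSubgroup.zmultiples ((1 / (Module.finrank K L : ℚ) : ℚ) : AddCircle (1 : ℚ)) := by
  apply le_antisymm
  · rintro _ ⟨u, rfl⟩
    induction u using groupCohomology.H2_induction_on with | h φ => ?_
    obtain ⟨x, hx⟩ := exists_baseUnit_eq (cocycleSum (Rep.ofAlgebraAutOnUnits K L) φ σ)
    rw [inv_H2π hur σ φ x hx.symm]
    refine ⟨ord K (Additive.ofMul x), ?_⟩
    change ord K (Additive.ofMul x) • _ = _
    rw [← AddCircle.coe_zsmul, zsmul_eq_mul, mul_one_div]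
  · rw [AddSubgroup.zmultiples_le]
    obtain ⟨φ, -, hφ⟩ := exists_carryCocycle_isFundamentalClass hur hϖ hσ
    exact ⟨_, hφ⟩

omit hσ in
-- Invariant `1/n` says exactly that `ord (S(σ)) ≡ 1` modulo `n`, so `S(σ)` and `ϖ` differ by a
-- norm.
theorem recip_frobenius (φ : groupCohomology.cocycles₂ (Rep.ofAlgebraAutOnUnits K L))
    (hφ : IsFundamentalClass σ (groupCohomology.H2π _ φ)) :
    recip φ σ = QuotientGroup.mk ϖ := by
  obtain ⟨x, hx⟩ := exists_baseUnit_eq (cocycleSum (Rep.ofAlgebraAutOnUnits K L) φ σ)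
  rw [IsFundamentalClass, inv_H2π hur σ φ x hx.symm] at hφ
  have := coe_div_eq_coe_div_iff (Module.finrank_pos (R := K) (M := L)).ne'
    (ord K (Additive.ofMul x)) 1
  rw [Int.cast_one] at this
  rw [recip_eq_mk φ σ x hx.symm, eq_comm, QuotientGroup.eq, mem_normSubgroup_iff hur hϖ]
  rw [this] at hφ
  rwa [ofMul_mul, ofMul_inv, map_add, map_neg, hϖ, neg_add_eq_sub]

/-- The valuation modulo `n` identifies `Kˣ / Nm(Lˣ)` with a cyclic group of order `n` generated by
`ϖ`, and the generator `σ` of order `n` goes to `ϖ`. -/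
theorem recip_bijective (φ : groupCohomology.cocycles₂ (Rep.ofAlgebraAutOnUnits K L))
    (hφ : IsFundamentalClass σ (groupCohomology.H2π _ φ)) :
    Function.Bijective (recip φ) := by
  have hrec := recip_frobenius hur hϖ φ hφ
  constructor
  · rw [injective_iff_map_eq_one]
    intro g hg
    obtain ⟨i, rfl⟩ := mem_powers_of_isFrobenius hur hϖ hσ g
    change recip φ (σ ^ i) = 1 at hg
    rw [map_pow, hrec, ← QuotientGroup.mk_pow, QuotientGroup.eq_one_iff,
      mem_normSubgroup_iff hur hϖ, ofMul_pow, map_nsmul, hϖ, nsmul_eq_mul, mul_one,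
      Int.natCast_dvd_natCast, ← orderOf_of_isFrobenius hur hϖ hσ] at hg
    exact orderOf_dvd_iff_pow_eq_one.1 hg
  · intro y
    induction y using QuotientGroup.induction_on with | H x => ?_
    refine ⟨σ ^ ord K (Additive.ofMul x), ?_⟩
    rw [map_zpow, hrec, ← QuotientGroup.mk_zpow, QuotientGroup.eq, mem_normSubgroup_iff hur hϖ,
      ofMul_mul, ofMul_inv, ofMul_zpow, map_add, map_neg, map_zsmul, hϖ]
    simp

end Invariant

end LocalReciprocity

end

theorem mainTheorem7 (K L : Type)
    [Field K] [ValuativeRel K] [TopologicalSpace K] [IsNonarchimedeanLocalField K]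
    [Field L] [ValuativeRel L] [TopologicalSpace L] [IsNonarchimedeanLocalField L]
    [Algebra K L] [ValuativeExtension K L] [FiniteDimensional K L] [IsGalois K L]
    (hur : LocalReciprocity.IsUnramifiedExtension K L)
    (ϖ : Kˣ) (hϖ : LocalReciprocity.ord K (Additive.ofMul ϖ) = 1) :
    (∃! σ : L ≃ₐ[K] L, LocalReciprocity.IsFrobenius σ) ∧
    ∀ σ : L ≃ₐ[K] L, LocalReciprocity.IsFrobenius σ →
      (Subgroup.zpowers σ = ⊤ ∧ orderOf σ = Module.finrank K L) ∧
      -- the invariant map is an isomorphism onto `(1/n)ℤ/ℤ`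
      (Function.Injective (LocalReciprocity.inv σ) ∧
        (LocalReciprocity.inv σ).range =
          AddSubgroup.zmultiples ((1 / (Module.finrank K L : ℚ) : ℚ) : AddCircle (1 : ℚ))) ∧
      -- an explicit cocycle represents the fundamental class
      (∃ φ : groupCohomology.cocycles₂ (Rep.ofAlgebraAutOnUnits K L),
        (∀ i j : ℕ, i < Module.finrank K L → j < Module.finrank K L →
          φ (σ ^ i, σ ^ j) = Additive.ofMul (if i + j ≤ Module.finrank K L - 1 then 1
            else Units.map (algebraMap K L : K →* L) ϖ)) ∧
        LocalReciprocity.IsFundamentalClass σ (groupCohomology.H2π _ φ)) ∧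
      -- the reciprocity isomorphism
      (∀ φ : groupCohomology.cocycles₂ (Rep.ofAlgebraAutOnUnits K L),
        LocalReciprocity.IsFundamentalClass σ (groupCohomology.H2π _ φ) →
        Function.Bijective (LocalReciprocity.recip φ) ∧
        LocalReciprocity.recip φ σ = QuotientGroup.mk ϖ) := by
  refine ⟨LocalReciprocity.existsUnique_isFrobenius hur hϖ, fun σ hσ =>
    ⟨⟨LocalReciprocity.zpowers_eq_top_of_isFrobenius hur hϖ hσ,
      LocalReciprocity.orderOf_of_isFrobenius hur hϖ hσ⟩,
    ⟨LocalReciprocity.inv_injective hur hϖ hσ, LocalReciprocity.range_inv hur hϖ hσ⟩,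
    LocalReciprocity.exists_carryCocycle_isFundamentalClass hur hϖ hσ,
    fun φ hφ => ⟨LocalReciprocity.recip_bijective hur hϖ hσ φ hφ,
      LocalReciprocity.recip_frobenius hur hϖ φ hφ⟩⟩⟩
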